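/- Let $A$ be the Cuntz algebra $\mathcal O_2$, i.e. a non-zero $C^*$-algebra generated by two isometries $S_1,S_2$ with $S_1S_1^*+S_2S_2^*=1$. For a finite word $\mu=\mu_1\cdots\mu_k$ in the letters $1,2$ put $S_\mu=S_{\mu_1}\cdots S_{\mu_k}$ (with $S_\emptyset=1$) and $P_\mu=S_\mu S_\mu^*$; let $\mathcal D_2$ be the $C^*$-subalgebra generated by all $P_\mu$. Let $V$ be the set of unitaries of $A$ of the form $\sum_{(\mu,\nu)\in J}S_\mu S_\nu^*$ with $J$ a finite set of pairs of words, and let $F\subseteq V$ be the set of those unitaries for which $J$ can be chosen so that $\mu\mapsto\nu$, $(\mu,\nu)\in J$, respects the lexicographic order (these are the standard representations of the Thompson groups $V$ and $F$). Call a unital $*$-endomorphism $\alpha$ of $A$ modestly scaling if for every sequence $(\nu_k)_{k\ge1}$ of non-empty words and every projection $p\in A$ with $p\le\alpha(P_{\nu_1\cdots\nu_k})$ for all $k$ one has $p=0$. There is a unique faithful conditional expectation $\Phi_{\mathcal D}\colon A\to\mathcal D_2$ with $\Phi_{\mathcal D}(S_\mu S_\nu^*)=0$ for all words $\mu\ne\nu$;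 for $w\in V$ write $\mathbf 1_w=\Phi_{\mathcal D}(w)$. If $\alpha$ is a modestly scaling unital $*$-endomorphism of $A$ with $\alpha(F)\subseteq V$, then $\alpha(\mathbf 1_w)=\mathbf 1_{\alpha(w)}$ for all $w\in F$, and consequently $\alpha(\mathcal D_2)\subseteq\mathcal D_2$. -/

import Mathlib

namespace CuntzThompson

/-- `S 0, …, S (n-1)` are isometries with `∑ i, S i (S i)* = 1` which generate the C*-algebra `A`,
i.e. `A` is (for `2 ≤ n` and `A ≠ 0`) the Cuntz algebra `𝒪_n` with its generators. -/
structure IsCuntzFamily {A : Type*} [CStarAlgebra A] {n : ℕ} (S : Fin n → A) : Prop where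
  isometry : ∀ i, star (S i) * S i = 1
  sum_range : ∑ i, S i * star (S i) = 1
  generates : (StarAlgebra.adjoin ℂ (Set.range S)).topologicalClosure = ⊤

/-- `S_μ = S_{μ₁} ⋯ S_{μ_k}` for a multi-index `μ`, with `S_∅ = 1`. -/
def wordIsometry {A : Type*} [CStarAlgebra A] {n : ℕ} (S : Fin n → A) (μ : List (Fin n)) : A :=
  (μ.map S).prod

/-- The range projection `P_μ = S_μ S_μ*`. -/
def wordProj {A : Type*} [CStarAlgebra A] {n : ℕ} (S : Fin n → A) (μ : List (Fin n)) : A :=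
  wordIsometry S μ * star (wordIsometry S μ)

/-- The diagonal `𝒟_n`: the C*-subalgebra generated by the projections `P_μ`. -/
noncomputable def diagonal {A : Type*} [CStarAlgebra A] {n : ℕ} (S : Fin n → A) :
    StarSubalgebra ℂ A :=
  (StarAlgebra.adjoin ℂ (Set.range (wordProj S))).topologicalClosure

/-- `Φ` is a faithful conditional expectation of `A` onto the diagonal which vanishes on
`S_μ S_ν*` whenever `μ ≠ ν`. -/
structure IsDiagonalExpectation {A : Type*} [CStarAlgebra A] [PartialOrder A] [StarOrderedRing A]
    {n : ℕ} (S : Fin n → A) (Φ : A →ₗ[ℂ] A) : Prop where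
  map_mem : ∀ x, Φ x ∈ diagonal S
  map_of_mem : ∀ d ∈ diagonal S, Φ d = d
  norm_le : ∀ x, ‖Φ x‖ ≤ ‖x‖
  nonneg : ∀ x, 0 ≤ x → 0 ≤ Φ x
  bimodule : ∀ d ∈ diagonal S, ∀ e ∈ diagonal S, ∀ x, Φ (d * x * e) = d * Φ x * e
  faithful : ∀ x, Φ (star x * x) = 0 → x = 0
  off_diagonal : ∀ μ ν : List (Fin n), μ ≠ ν → Φ (wordIsometry S μ * star (wordIsometry S ν)) = 0

/-- The conditional expectation `Φ_𝒟` of the Cuntz algebra onto its diagonal, i.e. the unique map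
satisfying `IsDiagonalExpectation`. -/
noncomputable def diagonalExpectation {A : Type*} [CStarAlgebra A] [PartialOrder A]
    [StarOrderedRing A] {n : ℕ} (S : Fin n → A) : A →ₗ[ℂ] A :=
  Classical.epsilon (IsDiagonalExpectation S)

/-- The element `𝟏_w = Φ_𝒟(w)`. -/
noncomputable def fixedProj {A : Type*} [CStarAlgebra A] [PartialOrder A] [StarOrderedRing A]
    {n : ℕ} (S : Fin n → A) (w : A) : A :=
  diagonalExpectation S w

/-- The element `∑_{(μ,ν) ∈ J} S_μ S_ν*` for a finite set `J` of pairs of multi-indices. -/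
def tableSum {A : Type*} [CStarAlgebra A] {n : ℕ} (S : Fin n → A)
    (J : Finset (List (Fin n) × List (Fin n))) : A :=
  ∑ p ∈ J, wordIsometry S p.1 * star (wordIsometry S p.2)

/-- The group `𝒮_n` of unitaries of the form `∑_{(μ,ν) ∈ J} S_μ S_ν*`. For `n = 2` this is
Thompson's group `V` in its representation in the unitary group of `𝒪_2`. -/
def tableUnitaries {A : Type*} [CStarAlgebra A] {n : ℕ} (S : Fin n → A) : Set A :=
  {w | w ∈ unitary A ∧ ∃ J, w = tableSum S J}

/-- Thompson's group `V`, represented as unitaries of `𝒪_2`. -/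
def thompsonV {A : Type*} [CStarAlgebra A] (S : Fin 2 → A) : Set A :=
  tableUnitaries S

/-- Thompson's group `F`, represented as the unitaries `∑_{(μ,ν) ∈ J} S_μ S_ν*` of `𝒪_2` for which
`μ ↦ ν` respects the lexicographic order (`<` on lists is the lexicographic order). When the sum is
unitary, `J` is automatically the graph of a bijection between two finite sets of pairwise
orthogonal multi-indices. -/
def thompsonF {A : Type*} [CStarAlgebra A] (S : Fin 2 → A) : Set A :=
  {w | w ∈ unitary A ∧ ∃ J, w = tableSum S J ∧ ∀ p ∈ J, ∀ q ∈ J, p.1 < q.1 → p.2 < q.2}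

/-- A unital `*`-endomorphism `α` is modestly scaling if for every sequence `ν` of non-empty
multi-indices, the only projection lying below `α (P_{ν₁⋯ν_k})` for all `k` is `0`. -/
def IsModestlyScaling {A : Type*} [CStarAlgebra A] [PartialOrder A] [StarOrderedRing A]
    {n : ℕ} (S : Fin n → A) (α : A →⋆ₐ[ℂ] A) : Prop :=
  ∀ ν : ℕ → List (Fin n), (∀ k, ν k ≠ []) →
    ∀ p : A, IsStarProjection p →
      (∀ k, p ≤ α (wordProj S ((List.range k).flatMap ν))) → p = 0

end CuntzThompson

/-! Fix `w` in F and put v = α(w) and q = α(Φ(w)). For a unitary u in V, Φ(u) is the projection onto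
the cylinders that a table of u fixes, and uΦ(u) = Φ(u) = Φ(u)u. Hence vq = q = qv, and q = Φ(v) has
to be shown. There are two inequalities, and each excludes fixed vectors.

Φ(v) ≤ q: if α(wⁿ)y = y with n ≥ 1 and qy = 0, then y = 0
(`IsModestlyScaling.eq_zero_of_mem_thompsonF`). Take a pair (μ,ν) of the table of `w`. If μ = ν,
then P_ν ≤ Φ(w). If one word properly extends the other, `w` or its inverse shrinks a cylinder into
itself along ν, νρ, νρρ, …; a fixed vector sees no difference between successive cylinders, so
modest scaling kills it. If the words are incomparable, order preservation makes the projection to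
the left of a cylinder grow under `w` or its inverse by at least that cylinder, which a fixed vector
does not see either. Applied to y = (1-q)Φ(vⁿ), this gives Φ(vⁿ) ≤ q for every n ≥ 1; since v fixes
q, also Φ(vⁿ) ≤ Φ(v).

q ≤ Φ(v): under d = 1-Φ(v) all powers of v therefore have zero expectation. If vy = y = dy and z =
yy*, averaging over N powers gives N²Φ(z) ≤ ‖z‖Nd, so Φ(z) = 0, and y = 0 by faithfulness
(`IsPinchLimit.eq_zero_of_mul_eq`). Take y = dq.

For the diagonal, a copy of x₀ supported on the cylinder of μ has expectation 1-P_μ, so α(P_μ) is 1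
minus an expectation and lies in the diagonal.

The expectation itself is built as the limit of block compressions by the isometries S_η S 0^L S 1
with |η| = L. These annihilate S_μ S_ν* for short words μ ≠ ν. Faithfulness is proved without a
gauge action: sums of shifted spikes play the role of a Fejér kernel. -/

namespace CuntzThompson

/-! ### Cuntz relations, matrix units and their dense span. -/

section Words

variable {A : Type*} [CStarAlgebra A] {S : Fin 2 → A}

/-- The matrix unit `S_μ S_ν*`. -/
def matUnit {n : ℕ} (S : Fin n → A) (μ ν : List (Fin n)) : A :=
  wordIsometry S μ * star (wordIsometry S ν)

theorem wordIsometry_nil {n : ℕ} (S : Fin n → A) : wordIsometry S [] = 1 := rfl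

theorem wordIsometry_cons {n : ℕ} (S : Fin n → A) (i : Fin n) (μ : List (Fin n)) :
    wordIsometry S (i :: μ) = S i * wordIsometry S μ := by
  simp [wordIsometry]

theorem wordIsometry_append {n : ℕ} (S : Fin n → A) (μ ν : List (Fin n)) :
    wordIsometry S (μ ++ ν) = wordIsometry S μ * wordIsometry S ν := by
  simp [wordIsometry]

theorem matUnit_self {n : ℕ} (S : Fin n → A) (μ : List (Fin n)) :
    matUnit S μ μ = wordProj S μ := rfl

theorem star_matUnit {n : ℕ} (S : Fin n → A) (μ ν : List (Fin n)) :
    star (matUnit S μ ν) = matUnit S ν μ := by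
  simp [matUnit]

theorem matUnit_nil_nil {n : ℕ} (S : Fin n → A) : matUnit S [] [] = 1 := by
  simp [matUnit, wordIsometry_nil]

theorem matUnit_cons_cons {n : ℕ} (S : Fin n → A) (i j : Fin n) (μ ν : List (Fin n)) :
    matUnit S (i :: μ) (j :: ν) = S i * matUnit S μ ν * star (S j) := by
  simp [matUnit, wordIsometry_cons, mul_assoc]

theorem wordProj_nil {n : ℕ} (S : Fin n → A) : wordProj S [] = 1 := matUnit_nil_nil S

theorem wordProj_cons {n : ℕ} (S : Fin n → A) (i : Fin n) (μ : List (Fin n)) :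
    wordProj S (i :: μ) = S i * wordProj S μ * star (S i) := matUnit_cons_cons S i i μ μ

theorem star_wordProj {n : ℕ} (S : Fin n → A) (μ : List (Fin n)) :
    star (wordProj S μ) = wordProj S μ := star_matUnit S μ μ

namespace IsCuntzFamily

theorem sum_two (hS : IsCuntzFamily S) : S 0 * star (S 0) + S 1 * star (S 1) = 1 := by
  have := hS.sum_range
  rwa [Fin.sum_univ_two] at this

/-- Compressing the relation ∑ S_i S_i* = 1 by `S 1` gives 1 = x*x + 1 with x = S 0* S 1, so
orthogonality of the ranges need not be assumed. -/
theorem star_zero_mul_one (hS : IsCuntzFamily S) : star (S 0) * S 1 = 0 := by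
  have h0 := hS.isometry 1
  have h1 : star (S 1) * (S 0 * star (S 0) + S 1 * star (S 1)) * S 1 = 1 := by
    rw [hS.sum_two, mul_one, h0]
  have h2 : star (star (S 0) * S 1) * (star (S 0) * S 1) +
      (star (S 1) * S 1) * (star (S 1) * S 1) = 1 := by
    rw [← h1]; simp only [star_mul, star_star]; noncomm_ring
  rw [h0, mul_one, add_eq_right] at h2
  exact CStarRing.star_mul_self_eq_zero_iff _ |>.mp h2

theorem star_mul_eq_ite (hS : IsCuntzFamily S) (i j : Fin 2) :
    star (S i) * S j = if i = j then 1 else 0 := by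
  have h := hS.star_zero_mul_one
  have h' : star (S 1) * S 0 = 0 := by simpa using congrArg star h
  fin_cases i <;> fin_cases j <;> simp [hS.isometry, h, h']

theorem star_mul_of_ne (hS : IsCuntzFamily S) {i j : Fin 2} (h : i ≠ j) :
    star (S i) * S j = 0 := by
  rw [hS.star_mul_eq_ite, if_neg h]

theorem star_mul_mul (hS : IsCuntzFamily S) (i j : Fin 2) (x : A) :
    star (S i) * (S j * x) = if i = j then x else 0 := by
  rw [← mul_assoc, hS.star_mul_eq_ite]
  split_ifs <;> simp

theorem wordIsometry_isometry (hS : IsCuntzFamily S) (μ : List (Fin 2)) :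
    star (wordIsometry S μ) * wordIsometry S μ = 1 := by
  induction μ with
  | nil => simp [wordIsometry_nil]
  | cons i μ ih =>
    rw [wordIsometry_cons, star_mul, mul_assoc, ← mul_assoc (star (S i)), hS.isometry, one_mul, ih]

theorem star_wordIsometry_mul (hS : IsCuntzFamily S) (μ ν : List (Fin 2)) :
    (∃ ρ, ν = μ ++ ρ ∧ star (wordIsometry S μ) * wordIsometry S ν = wordIsometry S ρ) ∨
    (∃ ρ, ρ ≠ [] ∧ μ = ν ++ ρ ∧
      star (wordIsometry S μ) * wordIsometry S ν = star (wordIsometry S ρ)) ∨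
    (¬ μ <+: ν ∧ ¬ ν <+: μ ∧ star (wordIsometry S μ) * wordIsometry S ν = 0) := by
  induction μ generalizing ν with
  | nil => exact Or.inl ⟨ν, by simp [wordIsometry_nil]⟩
  | cons i μ ih =>
    cases ν with
    | nil => exact Or.inr (Or.inl ⟨i :: μ, by simp [wordIsometry_nil]⟩)
    | cons j ν =>
      rw [wordIsometry_cons, wordIsometry_cons, star_mul, mul_assoc, hS.star_mul_mul]
      by_cases h : i = j
      · subst h
        simpa [List.cons_prefix_cons] using ih ν
      · simp [h, List.cons_prefix_cons, Ne.symm h]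

theorem wordProj_mul_wordProj_of_not_prefix (hS : IsCuntzFamily S) {μ ν : List (Fin 2)}
    (h : ¬ μ <+: ν) (h' : ¬ ν <+: μ) : wordProj S μ * wordProj S ν = 0 := by
  have key : star (wordIsometry S μ) * wordIsometry S ν = 0 := by
    rcases hS.star_wordIsometry_mul μ ν with ⟨ρ, h1, -⟩ | ⟨ρ, -, h1, -⟩ | ⟨-, -, h1⟩
    · exact absurd ⟨ρ, h1.symm⟩ h
    · exact absurd ⟨ρ, h1.symm⟩ h'
    · exact h1
  rw [wordProj, wordProj, mul_assoc, ← mul_assoc (star _), key]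
  simp

theorem wordProj_isStarProjection (hS : IsCuntzFamily S) (μ : List (Fin 2)) :
    IsStarProjection (wordProj S μ) where
  isIdempotentElem := by
    rw [IsIdempotentElem, wordProj, mul_assoc, ← mul_assoc (star _), hS.wordIsometry_isometry,
      one_mul]
  isSelfAdjoint := star_wordProj S μ

theorem wordProj_append_mul (hS : IsCuntzFamily S) (μ ρ : List (Fin 2)) :
    wordProj S (μ ++ ρ) * wordProj S μ = wordProj S (μ ++ ρ) := by
  simp only [wordProj, wordIsometry_append, star_mul, mul_assoc]
  rw [← mul_assoc (star (wordIsometry S μ)) (wordIsometry S μ), hS.wordIsometry_isometry, one_mul]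

theorem wordProj_mul_wordIsometry (hS : IsCuntzFamily S) (μ : List (Fin 2)) :
    wordProj S μ * wordIsometry S μ = wordIsometry S μ := by
  rw [wordProj, mul_assoc, hS.wordIsometry_isometry, mul_one]

theorem wordIsometry_ne_zero [Nontrivial A] (hS : IsCuntzFamily S) (μ : List (Fin 2)) :
    wordIsometry S μ ≠ 0 := by
  intro h
  simpa [h] using hS.wordIsometry_isometry μ

theorem wordProj_ne_zero [Nontrivial A] (hS : IsCuntzFamily S) (μ : List (Fin 2)) :
    wordProj S μ ≠ 0 := by
  intro h
  apply hS.wordIsometry_ne_zero μ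
  rw [← hS.wordProj_mul_wordIsometry, h, zero_mul]

/-- The product of two matrix units is zero or a matrix unit. -/
theorem matUnit_mul_matUnit (hS : IsCuntzFamily S) (μ ν κ l : List (Fin 2)) :
    matUnit S μ ν * matUnit S κ l = 0 ∨
      ∃ μ' l', matUnit S μ ν * matUnit S κ l = matUnit S μ' l' := by
  have h : matUnit S μ ν * matUnit S κ l = wordIsometry S μ *
      (star (wordIsometry S ν) * wordIsometry S κ) * star (wordIsometry S l) := by
    simp only [matUnit, mul_assoc]
  rw [h]
  rcases hS.star_wordIsometry_mul ν κ with ⟨ρ, -, h1⟩ | ⟨ρ, -, -, h1⟩ | ⟨-, -, h1⟩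
  · exact Or.inr ⟨μ ++ ρ, l, by rw [h1, matUnit, wordIsometry_append]⟩
  · exact Or.inr ⟨μ, l ++ ρ, by rw [h1, matUnit, wordIsometry_append, star_mul, mul_assoc]⟩
  · exact Or.inl (by simp [h1])

end IsCuntzFamily

/-- The span of the matrix units `S_μ S_ν*` with both words of length at most `L`. -/
noncomputable def matSpan {n : ℕ} (S : Fin n → A) (L : ℕ) : Submodule ℂ A :=
  Submodule.span ℂ {x | ∃ μ ν, μ.length ≤ L ∧ ν.length ≤ L ∧ x = matUnit S μ ν}

theorem matUnit_mem_matSpan {n : ℕ} (S : Fin n → A) {L : ℕ} {μ ν : List (Fin n)}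
    (hμ : μ.length ≤ L) (hν : ν.length ≤ L) : matUnit S μ ν ∈ matSpan S L :=
  Submodule.subset_span ⟨μ, ν, hμ, hν, rfl⟩

theorem matSpan_mono {n : ℕ} (S : Fin n → A) : Monotone (matSpan S) := by
  intro L M h
  apply Submodule.span_mono
  rintro x ⟨μ, ν, h1, h2, rfl⟩
  exact ⟨μ, ν, h1.trans h, h2.trans h, rfl⟩

theorem matSpan_induction {n : ℕ} {S : Fin n → A} {L : ℕ} {p : (x : A) → x ∈ matSpan S L → Prop}
    (hu : ∀ μ ν (h1 : μ.length ≤ L) (h2 : ν.length ≤ L),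
      p (matUnit S μ ν) (matUnit_mem_matSpan S h1 h2))
    (h0 : p 0 (zero_mem _))
    (hadd : ∀ x y hx hy, p x hx → p y hy → p (x + y) (add_mem hx hy))
    (hsmul : ∀ (c : ℂ) x hx, p x hx → p (c • x) (Submodule.smul_mem _ c hx))
    {x : A} (hx : x ∈ matSpan S L) : p x hx := by
  induction hx using Submodule.span_induction with
  | mem x hx => obtain ⟨μ, ν, h1, h2, rfl⟩ := hx; exact hu μ ν h1 h2
  | zero => exact h0
  | add x y _ _ h1 h2 => exact hadd x y _ _ h1 h2
  | smul c x _ h => exact hsmul c x _ h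

namespace IsCuntzFamily

/-- The inductive step for everything proved letter by letter: compression by one generator neither
makes an off-diagonal unit diagonal nor raises the maximal word length. An empty word opposite a
non-empty one rotates a letter, and the maximum still bounds both lengths. -/
theorem star_mul_matUnit_mul_cases (hS : IsCuntzFamily S) (i : Fin 2) (μ ν : List (Fin 2)) :
    star (S i) * matUnit S μ ν * S i = 0 ∨
    ∃ μ' ν', star (S i) * matUnit S μ ν * S i = matUnit S μ' ν' ∧ (μ' = ν' ↔ μ = ν) ∧
      μ'.length ≤ max μ.length ν.length ∧ ν'.length ≤ max μ.length ν.length := by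
  rcases μ with _ | ⟨j, μ⟩ <;> rcases ν with _ | ⟨k, ν⟩
  · refine Or.inr ⟨[], [], by simp [matUnit_nil_nil, hS.isometry], by simp⟩
  · by_cases h : i = k
    · refine Or.inr ⟨[], ν ++ [i], ?_, by simp⟩
      subst h
      simp [matUnit, wordIsometry_nil, wordIsometry_cons, wordIsometry_append, mul_assoc,
        hS.isometry]
    · refine Or.inl ?_
      simp [matUnit, wordIsometry_nil, wordIsometry_cons, mul_assoc,
        hS.star_mul_of_ne (Ne.symm h)]
  · by_cases h : i = j
    · refine Or.inr ⟨μ ++ [i], [], ?_, by simp⟩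
      subst h
      simp [matUnit, wordIsometry_nil, wordIsometry_cons, wordIsometry_append,
        hS.star_mul_mul]
    · refine Or.inl ?_
      simp [matUnit, wordIsometry_nil, wordIsometry_cons, hS.star_mul_mul, h]
  · have key : star (S i) * matUnit S (j :: μ) (k :: ν) * S i =
        (star (S i) * S j) * matUnit S μ ν * (star (S k) * S i) := by
      rw [matUnit_cons_cons]; simp only [mul_assoc]
    rw [key, hS.star_mul_eq_ite, hS.star_mul_eq_ite]
    by_cases h : i = j
    · by_cases h' : k = i
      · refine Or.inr ⟨μ, ν, by simp [← h, h'], by simp [← h, h'], ?_, ?_⟩ <;>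
          simp only [List.length_cons] <;> omega
      · simp [h']
    · simp [h]

theorem star_mul_mul_mem_matSpan (hS : IsCuntzFamily S) (i : Fin 2) {L : ℕ} {x : A}
    (hx : x ∈ matSpan S L) : star (S i) * x * S i ∈ matSpan S L := by
  induction hx using matSpan_induction with
  | hu μ ν h1 h2 =>
    rcases hS.star_mul_matUnit_mul_cases i μ ν with h | ⟨μ', ν', h, -, h3, h4⟩
    · rw [h]; exact Submodule.zero_mem _
    · rw [h]; exact matUnit_mem_matSpan S (h3.trans (max_le h1 h2)) (h4.trans (max_le h1 h2))
  | h0 => simp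
  | hadd x y _ _ h1 h2 => rw [mul_add, add_mul]; exact add_mem h1 h2
  | hsmul c x _ h =>
    rw [mul_smul_comm, smul_mul_assoc]; exact Submodule.smul_mem _ c h

theorem exists_matSpan_of_mem_adjoin (hS : IsCuntzFamily S) {x : A}
    (hx : x ∈ StarAlgebra.adjoin ℂ (Set.range S)) : ∃ L, x ∈ matSpan S L := by
  have hmul : ∀ {L M : ℕ} {x y : A}, x ∈ matSpan S L → y ∈ matSpan S M →
      ∃ K, x * y ∈ matSpan S K := by
    intro L M x y hx hy
    induction hx using matSpan_induction with
    | hu μ ν h1 h2 =>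
      induction hy using matSpan_induction with
      | hu κ l h3 h4 =>
        rcases hS.matUnit_mul_matUnit μ ν κ l with h | ⟨μ', l', h⟩
        · exact ⟨0, by rw [h]; exact zero_mem _⟩
        · exact ⟨max μ'.length l'.length, by
            rw [h]; exact matUnit_mem_matSpan S (le_max_left _ _) (le_max_right _ _)⟩
      | h0 => exact ⟨0, by simp⟩
      | hadd x y _ _ h1 h2 =>
        obtain ⟨K, hK⟩ := h1
        obtain ⟨K', hK'⟩ := h2
        exact ⟨max K K', by
          rw [mul_add]
          exact add_mem (matSpan_mono S (le_max_left _ _) hK)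
            (matSpan_mono S (le_max_right _ _) hK')⟩
      | hsmul c x _ h =>
        obtain ⟨K, hK⟩ := h
        exact ⟨K, by rw [mul_smul_comm]; exact Submodule.smul_mem _ c hK⟩
    | h0 => exact ⟨0, by simp⟩
    | hadd x y _ _ h1 h2 =>
      obtain ⟨K, hK⟩ := h1
      obtain ⟨K', hK'⟩ := h2
      exact ⟨max K K', by
        rw [add_mul]
        exact add_mem (matSpan_mono S (le_max_left _ _) hK)
          (matSpan_mono S (le_max_right _ _) hK')⟩
    | hsmul c x _ h =>
      obtain ⟨K, hK⟩ := h
      exact ⟨K, by rw [smul_mul_assoc]; exact Submodule.smul_mem _ c hK⟩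
  induction hx using StarAlgebra.adjoin_induction with
  | mem x hx =>
    obtain ⟨i, rfl⟩ := hx
    refine ⟨1, ?_⟩
    have : S i = matUnit S [i] [] := by simp [matUnit, wordIsometry_cons, wordIsometry_nil]
    rw [this]
    exact matUnit_mem_matSpan S (by simp) (by simp)
  | algebraMap r =>
    refine ⟨0, ?_⟩
    rw [Algebra.algebraMap_eq_smul_one, ← matUnit_nil_nil S]
    exact Submodule.smul_mem _ _ (matUnit_mem_matSpan S (by simp) (by simp))
  | add x y _ _ h1 h2 =>
    obtain ⟨K, hK⟩ := h1
    obtain ⟨K', hK'⟩ := h2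
    exact ⟨max K K', add_mem (matSpan_mono S (le_max_left _ _) hK)
      (matSpan_mono S (le_max_right _ _) hK')⟩
  | mul x y _ _ h1 h2 =>
    obtain ⟨K, hK⟩ := h1
    obtain ⟨K', hK'⟩ := h2
    exact hmul hK hK'
  | star x hx h =>
    obtain ⟨K, hK⟩ := h
    clear hx
    refine ⟨K, ?_⟩
    induction hK using matSpan_induction with
    | hu μ ν h1 h2 => rw [star_matUnit]; exact matUnit_mem_matSpan S h2 h1
    | h0 => simp
    | hadd x y _ _ h1 h2 => rw [star_add]; exact add_mem h1 h2
    | hsmul c x _ h => rw [star_smul]; exact Submodule.smul_mem _ _ h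

theorem exists_matSpan_norm_sub_lt (hS : IsCuntzFamily S) (a : A) {ε : ℝ} (hε : 0 < ε) :
    ∃ L, ∃ y ∈ matSpan S L, ‖a - y‖ < ε := by
  have ha : a ∈ (StarAlgebra.adjoin ℂ (Set.range S)).topologicalClosure := by
    rw [hS.generates]; trivial
  rw [← SetLike.mem_coe, StarSubalgebra.topologicalClosure_coe, Metric.mem_closure_iff] at ha
  obtain ⟨y, hy, h⟩ := ha ε hε
  obtain ⟨L, hL⟩ := hS.exists_matSpan_of_mem_adjoin hy
  exact ⟨L, y, hL, by rwa [← dist_eq_norm]⟩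

/-- A closed property of elements which is linear holds everywhere once it holds for the matrix
units. -/
theorem dense_induction (hS : IsCuntzFamily S) {p : A → Prop} (hc : IsClosed {x | p x})
    (hu : ∀ μ ν, p (matUnit S μ ν)) (h0 : p 0)
    (hadd : ∀ x y, p x → p y → p (x + y)) (hsmul : ∀ (c : ℂ) x, p x → p (c • x)) (a : A) :
    p a := by
  refine hc.closure_subset (Metric.mem_closure_iff.mpr fun ε hε => ?_)
  obtain ⟨L, y, hy, h⟩ := hS.exists_matSpan_norm_sub_lt a hε
  exact ⟨y, matSpan_induction (p := fun x _ => p x) (fun μ ν _ _ => hu μ ν) h0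
    (fun x y _ _ => hadd x y) (fun c x _ => hsmul c x) hy, by rwa [dist_eq_norm]⟩

end IsCuntzFamily

end Words

end CuntzThompson

namespace CuntzThompson

/-! ### Compression by spikes and convergence of the pinchings. -/

section Pinching

open Filter Topology

variable {A : Type*} [CStarAlgebra A] {S : Fin 2 → A}

/-- The isometry `S₁^L S₂`, whose powers of the shift have pairwise orthogonal ranges. -/
noncomputable def spike (S : Fin 2 → A) (L : ℕ) : A := S 0 ^ L * S 1

theorem spike_succ (S : Fin 2 → A) (L : ℕ) : spike S (L + 1) = S 0 * spike S L := by
  simp [spike, pow_succ', mul_assoc]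

namespace IsCuntzFamily

theorem star_spike_mul_spike (hS : IsCuntzFamily S) (a b : ℕ) :
    star (spike S a) * spike S b = if a = b then 1 else 0 := by
  have h10 : star (S 1) * S 0 = 0 := hS.star_mul_of_ne (by decide)
  induction a generalizing b with
  | zero =>
    cases b with
    | zero => simp [spike, hS.isometry]
    | succ b =>
      rw [spike_succ, ← mul_assoc]
      simp [spike, h10]
  | succ a ih =>
    cases b with
    | zero =>
      rw [spike_succ, star_mul, mul_assoc]
      simp [spike, hS.star_zero_mul_one]
    | succ b =>
      rw [spike_succ, spike_succ, star_mul, mul_assoc, hS.star_mul_mul]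
      simp [ih]

theorem spike_isometry (hS : IsCuntzFamily S) (L : ℕ) : star (spike S L) * spike S L = 1 := by
  simp [hS.star_spike_mul_spike]

theorem star_spike_mul_wordIsometry (hS : IsCuntzFamily S) {L : ℕ} {μ : List (Fin 2)}
    (h : μ.length ≤ L) : star (spike S L) * wordIsometry S μ = 0 ∨
      (μ = List.replicate μ.length 0 ∧
        star (spike S L) * wordIsometry S μ = star (spike S (L - μ.length))) := by
  induction μ generalizing L with
  | nil => simp [wordIsometry_nil]
  | cons i μ ih =>
    cases L with
    | zero => simp at h
    | succ L =>
      rw [spike_succ, star_mul, wordIsometry_cons, mul_assoc, hS.star_mul_mul]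
      by_cases hi : i = 0
      · subst hi
        simpa [List.replicate_succ] using ih (L := L) (by simpa using h)
      · simp [Ne.symm hi]

/-- Among words of length at most L only powers of the letter 0 meet the spike, and each leaves the
adjoint of a shorter spike. Distinct such words have distinct lengths, and spikes of distinct
lengths are orthogonal. -/
theorem spike_compress_matUnit (hS : IsCuntzFamily S) {L : ℕ} {μ ν : List (Fin 2)}
    (hμ : μ.length ≤ L) (hν : ν.length ≤ L) (hne : μ ≠ ν) :
    star (spike S L) * matUnit S μ ν * spike S L = 0 := by
  have h : star (spike S L) * matUnit S μ ν * spike S L =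
      (star (spike S L) * wordIsometry S μ) * star (star (spike S L) * wordIsometry S ν) := by
    simp [matUnit, mul_assoc]
  rw [h]
  rcases hS.star_spike_mul_wordIsometry hμ with h1 | ⟨h1, h1'⟩
  · simp [h1]
  rcases hS.star_spike_mul_wordIsometry hν with h2 | ⟨h2, h2'⟩
  · simp [h2]
  rw [h1', h2', star_star, hS.star_spike_mul_spike, if_neg]
  intro h3
  apply hne
  rw [h1, h2, show μ.length = ν.length by omega]

theorem exists_spike_compress_eq_smul (hS : IsCuntzFamily S) {L : ℕ} {y : A}
    (hy : y ∈ matSpan S L) : ∃ c : ℂ, star (spike S L) * y * spike S L = c • 1 := by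
  induction hy using matSpan_induction with
  | hu μ ν hμ hν =>
    by_cases hne : μ = ν
    · subst hne
      have h : star (spike S L) * matUnit S μ μ * spike S L =
          (star (spike S L) * wordIsometry S μ) * star (star (spike S L) * wordIsometry S μ) := by
        simp [matUnit, mul_assoc]
      rw [h]
      rcases hS.star_spike_mul_wordIsometry hμ with h1 | ⟨-, h1⟩
      · exact ⟨0, by simp [h1]⟩
      · exact ⟨1, by rw [h1, star_star, hS.spike_isometry, one_smul]⟩
    · exact ⟨0, by rw [hS.spike_compress_matUnit hμ hν hne, zero_smul]⟩
  | h0 => exact ⟨0, by simp⟩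
  | hadd x y _ _ h1 h2 =>
    obtain ⟨c, hc⟩ := h1
    obtain ⟨d, hd⟩ := h2
    exact ⟨c + d, by rw [mul_add, add_mul, hc, hd, add_smul]⟩
  | hsmul c x _ h =>
    obtain ⟨d, hd⟩ := h
    exact ⟨c * d, by rw [mul_smul_comm, smul_mul_assoc, hd, mul_smul]⟩

theorem exists_compress_eq_smul (hS : IsCuntzFamily S) {L : ℕ} (η : List (Fin 2)) {y : A}
    (hy : y ∈ matSpan S L) :
    ∃ c : ℂ, star (wordIsometry S η * spike S L) * y * (wordIsometry S η * spike S L) = c • 1 := by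
  induction η generalizing y with
  | nil => simpa [wordIsometry_nil] using hS.exists_spike_compress_eq_smul hy
  | cons i η ih =>
    obtain ⟨c, hc⟩ := ih (hS.star_mul_mul_mem_matSpan i hy)
    refine ⟨c, ?_⟩
    rw [← hc]
    simp only [wordIsometry_cons, star_mul, mul_assoc]

end IsCuntzFamily

/-- The block diagonal map `y ↦ ∑ S_η t* S_η* y S_η t S_η*`, the sum being over all words `η` of
length `m`. -/
noncomputable def pinch (S : Fin 2 → A) (t : A) : ℕ → A →ₗ[ℂ] A
  | 0 => LinearMap.mulLeft ℂ (star t) ∘ₗ LinearMap.mulRight ℂ t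
  | m + 1 => ∑ i, (LinearMap.mulLeft ℂ (S i) ∘ₗ LinearMap.mulRight ℂ (star (S i))) ∘ₗ
      pinch S t m ∘ₗ (LinearMap.mulLeft ℂ (star (S i)) ∘ₗ LinearMap.mulRight ℂ (S i))

theorem pinch_zero_apply (S : Fin 2 → A) (t y : A) : pinch S t 0 y = star t * y * t := by
  simp [pinch, mul_assoc]

theorem pinch_succ_apply (S : Fin 2 → A) (t : A) (m : ℕ) (y : A) :
    pinch S t (m + 1) y = ∑ i, S i * pinch S t m (star (S i) * y * S i) * star (S i) := by
  simp [pinch, mul_assoc]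

theorem pinch_star (S : Fin 2 → A) (t : A) (m : ℕ) (y : A) :
    pinch S t m (star y) = star (pinch S t m y) := by
  induction m generalizing y with
  | zero => simp [pinch_zero_apply, mul_assoc]
  | succ m ih =>
    simp only [pinch_succ_apply, star_sum, star_mul, star_star]
    refine Finset.sum_congr rfl fun i _ => ?_
    rw [← ih, mul_assoc]
    simp [mul_assoc]

theorem norm_star_mul_mul_le {u : A} (hu : star u * u = 1) (y : A) : ‖star u * y * u‖ ≤ ‖y‖ := by
  have h1 : ‖u‖ ≤ 1 := by
    have h2 : ‖u‖ * ‖u‖ ≤ 1 := by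
      rw [← CStarRing.norm_star_mul_self, hu]
      rcases subsingleton_or_nontrivial A with h | h
      · simp [Subsingleton.elim (1 : A) 0]
      · rw [CStarRing.norm_one]
    nlinarith [norm_nonneg u]
  calc ‖star u * y * u‖ ≤ ‖star u‖ * ‖y‖ * ‖u‖ := norm_mul₃_le
    _ ≤ 1 * ‖y‖ * 1 := by rw [norm_star]; gcongr
    _ = ‖y‖ := by ring

namespace IsCuntzFamily

theorem wordIsometry_mul_isometry (hS : IsCuntzFamily S) (η : List (Fin 2)) {t : A}
    (ht : star t * t = 1) : star (wordIsometry S η * t) * (wordIsometry S η * t) = 1 := by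
  rw [star_mul, mul_assoc, ← mul_assoc (star (wordIsometry S η)), hS.wordIsometry_isometry,
    one_mul, ht]

theorem pinch_wordProj_mul (hS : IsCuntzFamily S) (t : A) {m : ℕ} {μ : List (Fin 2)}
    (h : μ.length ≤ m) (y : A) :
    pinch S t m (wordProj S μ * y) = wordProj S μ * pinch S t m y := by
  induction μ generalizing m y with
  | nil => simp [wordProj_nil]
  | cons j μ ih =>
    cases m with
    | zero => simp at h
    | succ m =>
      have key : ∀ i, star (S i) * (wordProj S (j :: μ) * y) * S i =
          if i = j then wordProj S μ * (star (S i) * y * S i) else 0 := by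
        intro i
        rw [wordProj_cons]
        simp only [mul_assoc, hS.star_mul_mul]
        split_ifs with hi <;> simp [hi, mul_assoc]
      rw [pinch_succ_apply, pinch_succ_apply, Finset.mul_sum]
      refine Finset.sum_congr rfl fun i _ => ?_
      rw [key]
      by_cases hi : i = j
      · subst hi
        rw [if_pos rfl, ih (by simpa using h), wordProj_cons]
        simp [mul_assoc, hS.star_mul_mul]
      · simp only [hi, if_false, map_zero, mul_zero, zero_mul, wordProj_cons, mul_assoc]
        rw [← mul_assoc (star (S j)), hS.star_mul_of_ne (Ne.symm hi)]
        simp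

theorem pinch_one (hS : IsCuntzFamily S) {t : A} (ht : star t * t = 1) (m : ℕ) :
    pinch S t m 1 = 1 := by
  induction m with
  | zero => simp [pinch_zero_apply, ht]
  | succ m ih => simp only [pinch_succ_apply, mul_one, hS.isometry, ih, hS.sum_range]

theorem pinch_wordProj (hS : IsCuntzFamily S) {t : A} (ht : star t * t = 1) {m : ℕ}
    {μ : List (Fin 2)} (h : μ.length ≤ m) : pinch S t m (wordProj S μ) = wordProj S μ := by
  rw [← mul_one (wordProj S μ), hS.pinch_wordProj_mul t h, hS.pinch_one ht]

theorem pinch_matUnit (hS : IsCuntzFamily S) (m : ℕ) {L : ℕ} {μ ν : List (Fin 2)}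
    (hμ : μ.length ≤ L) (hν : ν.length ≤ L) (hne : μ ≠ ν) :
    pinch S (spike S L) m (matUnit S μ ν) = 0 := by
  induction m generalizing μ ν with
  | zero => rw [pinch_zero_apply, hS.spike_compress_matUnit hμ hν hne]
  | succ m ih =>
    rw [pinch_succ_apply]
    refine Finset.sum_eq_zero fun i _ => ?_
    rcases hS.star_mul_matUnit_mul_cases i μ ν with h | ⟨μ', ν', h, h2, h3, h4⟩
    · simp [h]
    · rw [h, ih (h3.trans (max_le hμ hν)) (h4.trans (max_le hμ hν)) (by rwa [Ne, h2])]
      simp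

/-- From L = K on, the pinchings keep the diagonal units and kill the others, hence are constant in
L. Contractivity then yields convergence on the closure, which is all of `A`. -/
theorem exists_pinch_eq (hS : IsCuntzFamily S) {K : ℕ} {y : A} (hy : y ∈ matSpan S K) :
    ∃ z, ∀ L, K ≤ L → pinch S (spike S L) L y = z := by
  induction hy using matSpan_induction with
  | hu μ ν hμ hν =>
    by_cases hne : μ = ν
    · subst hne
      exact ⟨wordProj S μ, fun L hL => hS.pinch_wordProj (hS.spike_isometry L) (hμ.trans hL)⟩
    · exact ⟨0, fun L hL => hS.pinch_matUnit L (hμ.trans hL) (hν.trans hL) hne⟩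
  | h0 => exact ⟨0, by simp⟩
  | hadd x y _ _ h1 h2 =>
    obtain ⟨z, hz⟩ := h1
    obtain ⟨w, hw⟩ := h2
    exact ⟨z + w, fun L hL => by rw [map_add, hz L hL, hw L hL]⟩
  | hsmul c x _ h =>
    obtain ⟨z, hz⟩ := h
    exact ⟨c • z, fun L hL => by rw [map_smul, hz L hL]⟩

end IsCuntzFamily

variable [PartialOrder A] [StarOrderedRing A]

theorem pinch_nonneg (S : Fin 2 → A) (t : A) (m : ℕ) {y : A} (hy : 0 ≤ y) :
    0 ≤ pinch S t m y := by
  induction m generalizing y with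
  | zero => rw [pinch_zero_apply]; exact star_left_conjugate_nonneg hy t
  | succ m ih =>
    rw [pinch_succ_apply]
    exact Finset.sum_nonneg fun i _ =>
      star_right_conjugate_nonneg (ih (star_left_conjugate_nonneg hy _)) _

namespace IsCuntzFamily

/-- The sum c is block diagonal, so c*c = ∑ S_i b_i* b_i S_i*, which is at most r² ∑ S_i S_i* = r².
-/
theorem norm_sum_conj_le (hS : IsCuntzFamily S) {b : Fin 2 → A} {r : ℝ} (hr : 0 ≤ r)
    (hb : ∀ i, ‖b i‖ ≤ r) : ‖∑ i, S i * b i * star (S i)‖ ≤ r := by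
  have h01 := hS.star_zero_mul_one
  have h10 : star (S 1) * S 0 = 0 := hS.star_mul_of_ne (by decide)
  set c := ∑ i, S i * b i * star (S i) with hc
  have h1 : star c * c = ∑ i, S i * (star (b i) * b i) * star (S i) := by
    rw [hc, Fin.sum_univ_two, Fin.sum_univ_two]
    simp only [star_add, star_mul, star_star, add_mul, mul_add, mul_assoc, hS.star_mul_mul]
    simp
  have h2 : star c * c ≤ algebraMap ℝ A (r ^ 2) := by
    have h3 : ∀ i, star (b i) * b i ≤ algebraMap ℝ A (r ^ 2) := fun i =>
      (CStarAlgebra.norm_le_iff_le_algebraMap _ (by positivity) (star_mul_self_nonneg _)).mp <| by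
        rw [CStarRing.norm_star_mul_self, ← sq]
        gcongr
        exact hb i
    rw [h1]
    calc _ ≤ ∑ i, S i * algebraMap ℝ A (r ^ 2) * star (S i) :=
          Finset.sum_le_sum fun i _ => star_right_conjugate_le_conjugate (h3 i) _
      _ = algebraMap ℝ A (r ^ 2) * ∑ i, S i * star (S i) := by
          rw [Finset.mul_sum]
          refine Finset.sum_congr rfl fun i _ => ?_
          rw [← mul_assoc, Algebra.commutes]
      _ = _ := by rw [hS.sum_range, mul_one]
  have h4 : ‖c‖ ^ 2 ≤ r ^ 2 := by
    rw [sq ‖c‖, ← CStarRing.norm_star_mul_self]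
    exact (CStarAlgebra.norm_le_iff_le_algebraMap _ (by positivity) (star_mul_self_nonneg _)).mpr h2
  exact abs_le_of_sq_le_sq' h4 hr |>.2

theorem norm_pinch_le_of_forall (hS : IsCuntzFamily S) {t : A} {m : ℕ} {y : A} {r : ℝ}
    (hr : 0 ≤ r) (h : ∀ η : List (Fin 2), η.length = m →
      ‖star (wordIsometry S η * t) * y * (wordIsometry S η * t)‖ ≤ r) :
    ‖pinch S t m y‖ ≤ r := by
  induction m generalizing y with
  | zero => simpa [pinch_zero_apply, wordIsometry_nil] using h [] rfl
  | succ m ih =>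
    rw [pinch_succ_apply]
    refine hS.norm_sum_conj_le hr fun i => ih fun η hη => ?_
    have := h (i :: η) (by simp [hη])
    simpa only [wordIsometry_cons, star_mul, mul_assoc] using this

theorem norm_pinch_le (hS : IsCuntzFamily S) {t : A} (ht : star t * t = 1) (m : ℕ) (y : A) :
    ‖pinch S t m y‖ ≤ ‖y‖ :=
  hS.norm_pinch_le_of_forall (norm_nonneg y) fun η _ =>
    norm_star_mul_mul_le (hS.wordIsometry_mul_isometry η ht) y

theorem exists_tendsto_pinch (hS : IsCuntzFamily S) (a : A) :
    ∃ b, Tendsto (fun L => pinch S (spike S L) L a) atTop (𝓝 b) := by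
  apply cauchySeq_tendsto_of_complete
  rw [Metric.cauchySeq_iff']
  intro ε hε
  obtain ⟨K, y, hy, h⟩ := hS.exists_matSpan_norm_sub_lt a (half_pos hε)
  obtain ⟨z, hz⟩ := hS.exists_pinch_eq hy
  refine ⟨K, fun L hL => ?_⟩
  have key : ∀ M, K ≤ M → ‖pinch S (spike S M) M a - z‖ < ε / 2 := by
    intro M hM
    rw [← hz M hM, ← map_sub]
    exact (hS.norm_pinch_le (hS.spike_isometry M) M _).trans_lt h
  have e : pinch S (spike S L) L a - pinch S (spike S K) K a =
      (pinch S (spike S L) L a - z) - (pinch S (spike S K) K a - z) := by abel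
  rw [dist_eq_norm, e]
  calc _ ≤ _ := norm_sub_le _ _
    _ < ε / 2 + ε / 2 := add_lt_add (key L hL) (key K le_rfl)
    _ = ε := add_halves ε

theorem exists_linearMap_tendsto_pinch (hS : IsCuntzFamily S) :
    ∃ Φ : A →ₗ[ℂ] A, ∀ a, Tendsto (fun L => pinch S (spike S L) L a) atTop (𝓝 (Φ a)) := by
  choose f hf using hS.exists_tendsto_pinch
  exact ⟨linearMapOfTendsto f (fun L => pinch S (spike S L) L) (tendsto_pi_nhds.mpr hf), hf⟩

end IsCuntzFamily

end Pinching

end CuntzThompson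

namespace CuntzThompson

/-! ### Bimodule and equivariance properties of the limit of the pinchings. -/

section Expectation

open Filter Topology

variable {A : Type*} [CStarAlgebra A] {S : Fin 2 → A}

theorem wordProj_mem_diagonal {n : ℕ} (S : Fin n → A) (μ : List (Fin n)) :
    wordProj S μ ∈ diagonal S :=
  StarSubalgebra.le_topologicalClosure _ (StarAlgebra.subset_adjoin ℂ _ ⟨μ, rfl⟩)

theorem isClosed_diagonal {n : ℕ} (S : Fin n → A) : IsClosed (diagonal S : Set A) :=
  StarSubalgebra.isClosed_topologicalClosure _

/-- The limit of the pinchings of `a` along the spikes is `Φ a`. -/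
def IsPinchLimit (S : Fin 2 → A) (Φ : A →ₗ[ℂ] A) : Prop :=
  ∀ a, Tendsto (fun L => pinch S (spike S L) L a) atTop (𝓝 (Φ a))

namespace IsPinchLimit

variable {Φ : A →ₗ[ℂ] A}

theorem map_star (hΦ : IsPinchLimit S Φ) (a : A) : Φ (star a) = star (Φ a) := by
  refine tendsto_nhds_unique (hΦ (star a)) ?_
  simp only [pinch_star]
  exact (hΦ a).star

theorem wordProj_mul (hΦ : IsPinchLimit S Φ) (hS : IsCuntzFamily S) (μ : List (Fin 2)) (x : A) :
    Φ (wordProj S μ * x) = wordProj S μ * Φ x := by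
  refine tendsto_nhds_unique (hΦ _) (((hΦ x).const_mul (wordProj S μ)).congr' ?_)
  filter_upwards [eventually_ge_atTop μ.length] with L hL
  rw [hS.pinch_wordProj_mul _ hL]

theorem map_matUnit (hΦ : IsPinchLimit S Φ) (hS : IsCuntzFamily S) {μ ν : List (Fin 2)}
    (h : μ ≠ ν) : Φ (matUnit S μ ν) = 0 := by
  refine tendsto_nhds_unique (hΦ _) (tendsto_const_nhds.congr' ?_)
  filter_upwards [eventually_ge_atTop μ.length, eventually_ge_atTop ν.length] with L hL hL'
  rw [hS.pinch_matUnit L hL hL' h]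

theorem map_wordProj (hΦ : IsPinchLimit S Φ) (hS : IsCuntzFamily S) (μ : List (Fin 2)) :
    Φ (wordProj S μ) = wordProj S μ := by
  refine tendsto_nhds_unique (hΦ _) (tendsto_const_nhds.congr' ?_)
  filter_upwards [eventually_ge_atTop μ.length] with L hL
  rw [hS.pinch_wordProj (hS.spike_isometry L) hL]

theorem map_one (hΦ : IsPinchLimit S Φ) (hS : IsCuntzFamily S) : Φ 1 = 1 := by
  simpa [wordProj_nil] using hΦ.map_wordProj hS []

/-- The spike already ignores off-diagonal units. This passes information from Φ back to honest
compressions and starts the proof of faithfulness. -/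
theorem spike_compress (hΦ : IsPinchLimit S Φ) (hS : IsCuntzFamily S) {L : ℕ} {y : A}
    (hy : y ∈ matSpan S L) :
    star (spike S L) * Φ y * spike S L = star (spike S L) * y * spike S L := by
  induction hy using matSpan_induction with
  | hu μ ν hμ hν =>
    by_cases hne : μ = ν
    · subst hne
      rw [matUnit_self, hΦ.map_wordProj hS]
    · rw [hΦ.map_matUnit hS hne, hS.spike_compress_matUnit hμ hν hne]
      simp
  | h0 => simp
  | hadd x y _ _ h1 h2 => simp only [map_add, mul_add, add_mul, h1, h2]
  | hsmul c x _ h => simp only [map_smul, mul_smul_comm, smul_mul_assoc, h]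

variable [PartialOrder A] [StarOrderedRing A]

theorem norm_le (hΦ : IsPinchLimit S Φ) (hS : IsCuntzFamily S) (a : A) : ‖Φ a‖ ≤ ‖a‖ :=
  le_of_tendsto (hΦ a).norm (Eventually.of_forall fun L =>
    hS.norm_pinch_le (hS.spike_isometry L) L a)

theorem continuous (hΦ : IsPinchLimit S Φ) (hS : IsCuntzFamily S) : Continuous Φ :=
  AddMonoidHomClass.continuous_of_bound Φ 1 fun x => by simpa using hΦ.norm_le hS x

theorem nonneg (hΦ : IsPinchLimit S Φ) {a : A} (ha : 0 ≤ a) : 0 ≤ Φ a :=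
  ge_of_tendsto (hΦ a) (Eventually.of_forall fun L => pinch_nonneg S _ L ha)

theorem map_mem (hΦ : IsPinchLimit S Φ) (hS : IsCuntzFamily S) (a : A) : Φ a ∈ diagonal S := by
  refine hS.dense_induction (p := fun a => Φ a ∈ diagonal S)
    ((isClosed_diagonal S).preimage (hΦ.continuous hS)) ?_ (by simp)
    (fun x y hx hy => by rw [map_add]; exact add_mem hx hy)
    (fun c x hx => by rw [map_smul]; exact SMulMemClass.smul_mem c hx) a
  intro μ ν
  by_cases h : μ = ν
  · subst h
    rw [matUnit_self, hΦ.map_wordProj hS]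
    exact wordProj_mem_diagonal S μ
  · rw [hΦ.map_matUnit hS h]
    exact zero_mem _

theorem diagonal_mul (hΦ : IsPinchLimit S Φ) (hS : IsCuntzFamily S) {d : A} (hd : d ∈ diagonal S) :
    ∀ x, Φ (d * x) = d * Φ x ∧ Φ (x * d) = Φ x * d := by
  have hc : IsClosed {d : A | ∀ x, Φ (d * x) = d * Φ x ∧ Φ (x * d) = Φ x * d} := by
    have := hΦ.continuous hS
    simp only [Set.ofPred_forall, Set.ofPred_and]
    exact isClosed_iInter fun x => (isClosed_eq (by fun_prop) (by fun_prop)).inter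
      (isClosed_eq (by fun_prop) (by fun_prop))
  refine hc.closure_subset_iff.mpr ?_ hd
  intro d hd
  induction hd using StarAlgebra.adjoin_induction with
  | mem d h =>
    obtain ⟨μ, rfl⟩ := h
    intro x
    refine ⟨hΦ.wordProj_mul hS μ x, ?_⟩
    rw [← star_inj, ← hΦ.map_star, star_mul, star_mul, star_wordProj, hΦ.wordProj_mul hS,
      hΦ.map_star]
  | algebraMap r => intro x; simp [Algebra.algebraMap_eq_smul_one]
  | add d e _ _ h1 h2 =>
    intro x
    simp only [add_mul, mul_add, map_add, (h1 x).1, (h1 x).2, (h2 x).1, (h2 x).2, and_self]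
  | mul d e _ _ h1 h2 =>
    intro x
    rw [mul_assoc, (h1 _).1, (h2 _).1, ← mul_assoc x, (h2 _).2, (h1 _).2, mul_assoc, mul_assoc]
    simp
  | star d _ h =>
    intro x
    constructor
    · rw [← star_inj, ← hΦ.map_star, star_mul, star_star, (h _).2, hΦ.map_star]; simp
    · rw [← star_inj, ← hΦ.map_star, star_mul, star_star, (h _).1, hΦ.map_star]; simp

theorem map_of_mem (hΦ : IsPinchLimit S Φ) (hS : IsCuntzFamily S) {d : A} (hd : d ∈ diagonal S) :
    Φ d = d := by
  simpa [hΦ.map_one hS] using (hΦ.diagonal_mul hS hd 1).1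

theorem mul_mul_star (hΦ : IsPinchLimit S Φ) (hS : IsCuntzFamily S) (i : Fin 2) (x : A) :
    Φ (S i * x * star (S i)) = S i * Φ x * star (S i) := by
  have := hΦ.continuous hS
  refine hS.dense_induction (p := fun x => Φ (S i * x * star (S i)) = S i * Φ x * star (S i))
    (isClosed_eq (by fun_prop) (by fun_prop)) ?_ (by simp)
    (fun x y hx hy => by simp only [mul_add, add_mul, map_add, hx, hy])
    (fun c x hx => by simp only [mul_smul_comm, smul_mul_assoc, map_smul, hx]) x
  intro μ ν
  rw [← matUnit_cons_cons]
  by_cases h : μ = ν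
  · subst h
    rw [matUnit_self, matUnit_self, hΦ.map_wordProj hS, hΦ.map_wordProj hS, wordProj_cons]
  · rw [hΦ.map_matUnit hS h, hΦ.map_matUnit hS (by simpa using h)]
    simp

/-- Apply `mul_mul_star` to S_i* x S_i, pull the diagonal projections S_i S_i* out of Φ, and
compress by S_i. -/
theorem star_mul_mul (hΦ : IsPinchLimit S Φ) (hS : IsCuntzFamily S) (i : Fin 2) (x : A) :
    Φ (star (S i) * x * S i) = star (S i) * Φ x * S i := by
  have hd : S i * star (S i) ∈ diagonal S := by
    simpa [wordProj_cons, wordProj_nil] using wordProj_mem_diagonal S [i]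
  have h := hΦ.mul_mul_star hS i (star (S i) * x * S i)
  have h1 : S i * (star (S i) * x * S i) * star (S i) =
      (S i * star (S i)) * (x * (S i * star (S i))) := by simp only [mul_assoc]
  rw [h1, (hΦ.diagonal_mul hS hd _).1, (hΦ.diagonal_mul hS hd _).2] at h
  have h2 := congrArg (fun z => star (S i) * z * S i) h
  simp only [mul_assoc, hS.star_mul_mul, if_true] at h2
  rw [hS.isometry, mul_one, mul_one] at h2
  rw [mul_assoc, mul_assoc, h2]

end IsPinchLimit

end Expectation

/-! ### Shifted spikes and a substitute for the Fejér kernel. -/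

section Shift

variable {A : Type*} [CStarAlgebra A] {S : Fin 2 → A}

/-- The canonical shift endomorphism `x ↦ ∑ S_i x S_i*`. -/
noncomputable def shift (S : Fin 2 → A) (x : A) : A := ∑ i, S i * x * star (S i)

theorem shift_iterate_zero (S : Fin 2 → A) (m : ℕ) : (shift S)^[m] 0 = 0 := by
  induction m with
  | zero => rfl
  | succ m ih => rw [Function.iterate_succ_apply', ih]; simp [shift]

namespace IsCuntzFamily

theorem star_mul_shift (hS : IsCuntzFamily S) (i : Fin 2) (x : A) :
    star (S i) * shift S x = x * star (S i) := by
  rw [shift, Finset.mul_sum, Finset.sum_eq_single i]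
  · rw [mul_assoc, hS.star_mul_mul, if_pos rfl]
  · intro j _ hj
    rw [mul_assoc, hS.star_mul_mul, if_neg (Ne.symm hj)]
  · simp

theorem star_shift_mul_shift (hS : IsCuntzFamily S) (x y : A) :
    star (shift S x) * shift S y = shift S (star x * y) := by
  conv_lhs => rw [shift, star_sum, Finset.sum_mul]
  refine Finset.sum_congr rfl fun i _ => ?_
  simp only [star_mul, star_star, mul_assoc, hS.star_mul_shift]

theorem shift_one (hS : IsCuntzFamily S) : shift S 1 = 1 := by
  simp [shift, hS.sum_range]

theorem shift_iterate_one (hS : IsCuntzFamily S) (m : ℕ) : (shift S)^[m] 1 = 1 :=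
  Function.iterate_fixed hS.shift_one m

theorem star_shift_iterate_mul (hS : IsCuntzFamily S) (m : ℕ) (x y : A) :
    star ((shift S)^[m] x) * (shift S)^[m] y = (shift S)^[m] (star x * y) := by
  induction m with
  | zero => rfl
  | succ m ih => simp only [Function.iterate_succ_apply', hS.star_shift_mul_shift, ih]

theorem star_wordIsometry_mul_shift_iterate (hS : IsCuntzFamily S) (ν : List (Fin 2)) (j : ℕ)
    (x : A) : star (wordIsometry S ν) * (shift S)^[j + ν.length] x =
      (shift S)^[j] x * star (wordIsometry S ν) := by
  induction ν with
  | nil => simp [wordIsometry_nil]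
  | cons i ν ih =>
    rw [wordIsometry_cons, star_mul, List.length_cons, ← add_assoc, Function.iterate_succ_apply',
      mul_assoc, hS.star_mul_shift, ← mul_assoc, ih, mul_assoc]

theorem spike_eq_wordIsometry_mul (S : Fin 2 → A) {m L : ℕ} (h : m ≤ L) :
    spike S L = wordIsometry S (List.replicate m 0) * spike S (L - m) := by
  rw [wordIsometry, List.map_replicate, List.prod_replicate, spike, spike, ← mul_assoc, ← pow_add,
    Nat.add_sub_cancel' h]

/-- The adjoint of S 0^m, a tail factor of the adjoint spike, passes through the m-th shift, leaving
the spikes of lengths L-m and L side by side; these are orthogonal since m ≠ 0. -/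
theorem star_spike_mul_shift_iterate (hS : IsCuntzFamily S) {m L : ℕ} (hm : m ≠ 0) (h : m ≤ L) :
    star (spike S L) * (shift S)^[m] (spike S L) = 0 := by
  have h1 := hS.star_wordIsometry_mul_shift_iterate (List.replicate m 0) 0 (spike S L)
  rw [List.length_replicate, zero_add] at h1
  conv_lhs => rw [spike_eq_wordIsometry_mul S h, star_mul, mul_assoc,
    ← spike_eq_wordIsometry_mul S h]
  rw [h1, Function.iterate_zero, id, ← mul_assoc, hS.star_spike_mul_spike, if_neg (by omega),
    zero_mul]

theorem star_shift_iterate_spike_mul (hS : IsCuntzFamily S) {p q L : ℕ} (hp : p ≤ L) (hq : q ≤ L) :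
    star ((shift S)^[p] (spike S L)) * (shift S)^[q] (spike S L) = if p = q then 1 else 0 := by
  have key : ∀ p q : ℕ, p < q → q ≤ L →
      star ((shift S)^[p] (spike S L)) * (shift S)^[q] (spike S L) = 0 := by
    intro p q hpq hq
    obtain ⟨m, rfl⟩ := Nat.exists_eq_add_of_lt hpq
    rw [add_assoc, Function.iterate_add_apply, hS.star_shift_iterate_mul,
      hS.star_spike_mul_shift_iterate (by omega) (by omega), shift_iterate_zero]
  rcases lt_trichotomy p q with h | h | h
  · rw [key p q h hq, if_neg h.ne]
  · subst h
    rw [hS.star_shift_iterate_mul, hS.spike_isometry, hS.shift_iterate_one, if_pos rfl]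
  · rw [if_neg h.ne', ← star_inj, star_mul, star_star, key q p h hp, star_zero]

end IsCuntzFamily

/-- A multiple of an isometry whose compression approximates a Fejér mean of the gauge action. -/
noncomputable def fejer (S : Fin 2 → A) (L N a : ℕ) : A :=
  ∑ j ∈ Finset.range N, (shift S)^[j + a] (spike S L)

namespace IsCuntzFamily

/-- By orthonormality of the shifted spikes, c counts the common exponents of two intervals of
length N starting at a and b. This is the Fejér coefficient, and it differs from N by at most a + b.
-/
theorem star_fejer_mul_fejer (hS : IsCuntzFamily S) {L N k a b : ℕ} (ha : a ≤ k) (hb : b ≤ k)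
    (hL : N + k ≤ L) : ∃ c : ℕ, c ≤ N ∧ N ≤ c + (a + b) ∧
      star (fejer S L N a) * fejer S L N b = (c : ℂ) • 1 := by
  refine ⟨((Finset.range N).filter fun i => b ≤ i + a ∧ i + a - b < N).card, ?_, ?_, ?_⟩
  · simpa using Finset.card_filter_le (Finset.range N) _
  · have : Finset.Ico b (N - a) ⊆
        (Finset.range N).filter fun i => b ≤ i + a ∧ i + a - b < N := by
      intro i hi
      simp only [Finset.mem_Ico, Finset.mem_filter, Finset.mem_range] at hi ⊢
      omega
    have := Finset.card_le_card this
    rw [Nat.card_Ico] at this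
    omega
  · rw [fejer, fejer, star_sum, Finset.sum_mul, Finset.card_filter, Nat.cast_sum, Finset.sum_smul]
    refine Finset.sum_congr rfl fun i hi => ?_
    rw [Finset.mem_range] at hi
    rw [Finset.mul_sum]
    have h1 : ∀ j ∈ Finset.range N, star ((shift S)^[i + a] (spike S L)) *
        (shift S)^[j + b] (spike S L) = if i + a = j + b then 1 else 0 := fun j hj => by
      rw [Finset.mem_range] at hj
      exact hS.star_shift_iterate_spike_mul (by omega) (by omega)
    rw [Finset.sum_congr rfl h1]
    split_ifs with h
    · rw [Finset.sum_eq_single (i + a - b)]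
      · rw [if_pos (by omega)]; simp
      · intro j _ hj
        rw [if_neg (by omega)]
      · intro h'
        exact absurd (Finset.mem_range.mpr h.2) h'
    · rw [Finset.sum_eq_zero]
      · simp
      · intro j hj
        rw [Finset.mem_range] at hj
        rw [if_neg (by omega)]

theorem star_fejer_mul_self (hS : IsCuntzFamily S) {L N k : ℕ} (hL : N + k ≤ L) :
    star (fejer S L N k) * fejer S L N k = (N : ℂ) • 1 := by
  rw [fejer, star_sum, Finset.sum_mul]
  have : ∀ i ∈ Finset.range N, star ((shift S)^[i + k] (spike S L)) *
      ∑ j ∈ Finset.range N, (shift S)^[j + k] (spike S L) = 1 := by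
    intro i hi
    rw [Finset.mul_sum, Finset.sum_eq_single i]
    · rw [Finset.mem_range] at hi
      rw [hS.star_shift_iterate_spike_mul (by omega) (by omega), if_pos rfl]
    · intro j hj hij
      rw [Finset.mem_range] at hi hj
      rw [hS.star_shift_iterate_spike_mul (by omega) (by omega), if_neg (by omega)]
    · exact fun h => absurd hi h
  rw [Finset.sum_congr rfl this]
  simp [Nat.cast_smul_eq_nsmul]

theorem star_wordIsometry_mul_fejer (hS : IsCuntzFamily S) {k : ℕ} {ν : List (Fin 2)}
    (h : ν.length ≤ k) (L N : ℕ) : star (wordIsometry S ν) * fejer S L N k =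
      fejer S L N (k - ν.length) * star (wordIsometry S ν) := by
  rw [fejer, fejer, Finset.mul_sum, Finset.sum_mul]
  refine Finset.sum_congr rfl fun j _ => ?_
  rw [← hS.star_wordIsometry_mul_shift_iterate, add_assoc, Nat.sub_add_cancel h]

/-- Moving S_ν* past the kernel lowers its offset by |ν|, so each unit is multiplied by an overlap
count close to N. The error is bounded independently of N and L. -/
theorem exists_norm_fejer_compress_sub_le (hS : IsCuntzFamily S) {k : ℕ} {y : A}
    (hy : y ∈ matSpan S k) : ∃ C : ℝ, ∀ L N, N + k ≤ L →
      ‖star (fejer S L N k) * y * fejer S L N k - (N : ℂ) • y‖ ≤ C := by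
  induction hy using matSpan_induction with
  | hu μ ν hμ hν =>
    -- The two offsets k-|μ| and k-|ν| are at most k each, whence 2k.
    refine ⟨(2 * k : ℝ) * ‖matUnit S μ ν‖, fun L N hL => ?_⟩
    obtain ⟨c, hc1, hc2, hc⟩ := hS.star_fejer_mul_fejer (N := N) (Nat.sub_le k μ.length)
      (Nat.sub_le k ν.length) hL
    have h : star (fejer S L N k) * matUnit S μ ν * fejer S L N k = (c : ℂ) • matUnit S μ ν := by
      have h1 : star (fejer S L N k) * matUnit S μ ν * fejer S L N k =
          star (star (wordIsometry S μ) * fejer S L N k) *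
            (star (wordIsometry S ν) * fejer S L N k) := by
        simp [matUnit, mul_assoc]
      rw [h1, hS.star_wordIsometry_mul_fejer hμ, hS.star_wordIsometry_mul_fejer hν, star_mul,
        star_star, mul_assoc, ← mul_assoc (star (fejer S L N _)), hc]
      simp [matUnit]
    rw [h, ← sub_smul, norm_smul]
    gcongr
    have h2 : (c : ℂ) - N = ((c - N : ℝ) : ℂ) := by push_cast; rfl
    rw [h2, Complex.norm_real, Real.norm_eq_abs, abs_le]
    have h3 : (c : ℝ) ≤ N := by exact_mod_cast hc1
    have h4 : (N : ℝ) ≤ c + 2 * k := by exact_mod_cast (by omega : N ≤ c + 2 * k)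
    constructor <;> linarith [(Nat.cast_nonneg k : (0 : ℝ) ≤ k)]
  | h0 => exact ⟨0, by simp⟩
  | hadd x y _ _ h1 h2 =>
    obtain ⟨C, hC⟩ := h1
    obtain ⟨D, hD⟩ := h2
    refine ⟨C + D, fun L N h => ?_⟩
    rw [mul_add, add_mul, smul_add, add_sub_add_comm]
    exact (norm_add_le _ _).trans (add_le_add (hC L N h) (hD L N h))
  | hsmul c x _ h =>
    obtain ⟨C, hC⟩ := h
    refine ⟨‖c‖ * C, fun L N h => ?_⟩
    rw [mul_smul_comm, smul_mul_assoc, smul_comm _ c, ← smul_sub, norm_smul]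
    gcongr
    exact hC L N h

end IsCuntzFamily

end Shift

end CuntzThompson

namespace CuntzThompson

/-! ### Faithfulness, uniqueness, and projections in right ideals. -/

section Faithful

open Filter Topology

variable {A : Type*} [CStarAlgebra A] [PartialOrder A] [StarOrderedRing A] {S : Fin 2 → A}

namespace IsPinchLimit

variable {Φ : A →ₗ[ℂ] A}

theorem tendsto_spike_compress (hΦ : IsPinchLimit S Φ) (hS : IsCuntzFamily S) {a : A}
    (ha : Φ a = 0) :
    Tendsto (fun L => star (spike S L) * a * spike S L) atTop (𝓝 0) := by
  rw [Metric.tendsto_atTop]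
  intro ε hε
  obtain ⟨K, y, hy, h⟩ := hS.exists_matSpan_norm_sub_lt a (half_pos hε)
  refine ⟨K, fun L hL => ?_⟩
  have h1 := hΦ.spike_compress hS (matSpan_mono S hL hy)
  have h2 : star (spike S L) * a * spike S L =
      star (spike S L) * (a - y) * spike S L - star (spike S L) * Φ (a - y) * spike S L := by
    rw [map_sub, ha, zero_sub, mul_neg, neg_mul, h1, mul_sub, sub_mul]
    abel
  rw [dist_zero_right, h2]
  calc _ ≤ ‖star (spike S L) * (a - y) * spike S L‖ +
        ‖star (spike S L) * Φ (a - y) * spike S L‖ := norm_sub_le _ _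
    _ ≤ ‖a - y‖ + ‖a - y‖ := add_le_add (norm_star_mul_mul_le (hS.spike_isometry L) _)
        ((norm_star_mul_mul_le (hS.spike_isometry L) _).trans (hΦ.norm_le hS _))
    _ < ε / 2 + ε / 2 := add_lt_add h h
    _ = ε := add_halves ε

/-- The condition Φ(x*x) = 0 is inherited by x S_i, because Φ commutes with compression by S_i.
Induction on m then reduces to the plain spike. -/
theorem tendsto_mul_shift_spike (hΦ : IsPinchLimit S Φ) (hS : IsCuntzFamily S) (m : ℕ) {x : A}
    (hx : Φ (star x * x) = 0) :
    Tendsto (fun L => x * (shift S)^[m] (spike S L)) atTop (𝓝 0) := by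
  induction m generalizing x with
  | zero =>
    have h := (hΦ.tendsto_spike_compress hS hx).norm
    have h1 : ∀ L, ‖star (spike S L) * (star x * x) * spike S L‖ = ‖x * spike S L‖ ^ 2 := by
      intro L
      rw [sq, ← CStarRing.norm_star_mul_self, star_mul]
      simp only [mul_assoc]
    simp only [h1, norm_zero] at h
    have h2 := h.sqrt
    simp only [Real.sqrt_sq (norm_nonneg _), Real.sqrt_zero] at h2
    exact tendsto_zero_iff_norm_tendsto_zero.mpr h2
  | succ m ih =>
    have h1 : ∀ i, Φ (star (x * S i) * (x * S i)) = 0 := by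
      intro i
      have := hΦ.star_mul_mul hS i (star x * x)
      rw [hx, mul_zero, zero_mul] at this
      rw [← this, star_mul]
      simp only [mul_assoc]
    have h2 : Tendsto (fun L => ∑ i, x * S i * (shift S)^[m] (spike S L) * star (S i)) atTop
        (𝓝 (∑ i : Fin 2, 0 * star (S i))) :=
      tendsto_finsetSum _ fun i _ => (ih (h1 i)).mul_const _
    simp only [zero_mul, Finset.sum_const_zero] at h2
    refine h2.congr fun L => ?_
    rw [Function.iterate_succ_apply', shift, Finset.mul_sum]
    simp only [mul_assoc]

/-- Let U be the kernel with N terms. Compression by U nearly multiplies an approximant y of x*x by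
N, while xU tends to 0 as L grows; hence N‖y‖ is at most a constant plus N times a small error. -/
theorem faithful [Nontrivial A] (hΦ : IsPinchLimit S Φ) (hS : IsCuntzFamily S) {x : A}
    (hx : Φ (star x * x) = 0) : x = 0 := by
  rw [← CStarRing.star_mul_self_eq_zero_iff, ← norm_le_zero_iff]
  refine le_of_forall_pos_le_add fun ε hε => ?_
  rw [zero_add]
  obtain ⟨k, y, hy, hay⟩ := hS.exists_matSpan_norm_sub_lt (star x * x) (by positivity : 0 < ε / 3)
  obtain ⟨C, hC⟩ := hS.exists_norm_fejer_compress_sub_le hy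
  -- N is chosen first, to absorb the bound C and the 1 allowed for ‖U*x*xU‖. Only then is L taken
  -- large, which is possible because C is uniform in L.
  obtain ⟨N, hN⟩ := exists_nat_gt (max 0 ((C + 1) / (ε / 3)))
  have hN0 : (0 : ℝ) < N := (le_max_left _ _).trans_lt hN
  have hN1 : C + 1 < N * (ε / 3) := by
    rw [← div_lt_iff₀ (by positivity)]
    exact (le_max_right _ _).trans_lt hN
  have ht : Tendsto (fun L => x * fejer S L N k) atTop (𝓝 0) := by
    have := tendsto_finsetSum (Finset.range N) fun j _ =>
      hΦ.tendsto_mul_shift_spike hS (j + k) hx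
    simpa [fejer, Finset.mul_sum] using this
  obtain ⟨L, hL1, hL⟩ := ((ht.norm.eventually_lt_const (u := 1) (by simp)).and
    (eventually_ge_atTop (N + k))).exists
  set U := fejer S L N k
  have hU : ‖U‖ * ‖U‖ = N := by
    rw [← CStarRing.norm_star_mul_self, hS.star_fejer_mul_self hL, norm_smul]
    simp
  have h1 : ‖star U * (star x * x) * U‖ ≤ 1 := by
    have : star U * (star x * x) * U = star (x * U) * (x * U) := by simp [mul_assoc]
    rw [this, CStarRing.norm_star_mul_self]
    nlinarith [norm_nonneg (x * U)]
  have h2 : ‖star U * (star x * x - y) * U‖ ≤ N * (ε / 3) :=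
    calc _ ≤ ‖star U‖ * ‖star x * x - y‖ * ‖U‖ := norm_mul₃_le
      _ = (‖U‖ * ‖U‖) * ‖star x * x - y‖ := by rw [norm_star]; ring
      _ ≤ N * (ε / 3) := by rw [hU]; gcongr
  have h3 : (N : ℂ) • y = star U * (star x * x) * U - star U * (star x * x - y) * U -
      (star U * y * U - (N : ℂ) • y) := by
    rw [mul_sub, sub_mul]; abel
  have h4 : N * ‖y‖ ≤ N * (2 * (ε / 3)) :=
    calc N * ‖y‖ = ‖(N : ℂ) • y‖ := by rw [norm_smul]; simp
      _ ≤ ‖star U * (star x * x) * U‖ + ‖star U * (star x * x - y) * U‖ +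
          ‖star U * y * U - (N : ℂ) • y‖ := by
        conv_lhs => rw [h3]
        exact (norm_sub_le _ _).trans (add_le_add_left (norm_sub_le _ _) _)
      _ ≤ 1 + N * (ε / 3) + C := add_le_add (add_le_add h1 h2) (hC L N hL)
      _ ≤ N * (2 * (ε / 3)) := by linarith
  have h5 : ‖y‖ ≤ 2 * (ε / 3) := le_of_mul_le_mul_left h4 hN0
  calc ‖star x * x‖ = ‖(star x * x - y) + y‖ := by rw [sub_add_cancel]
    _ ≤ ‖star x * x - y‖ + ‖y‖ := norm_add_le _ _
    _ ≤ ε := by linarith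

theorem isDiagonalExpectation [Nontrivial A] (hΦ : IsPinchLimit S Φ) (hS : IsCuntzFamily S) :
    IsDiagonalExpectation S Φ where
  map_mem := hΦ.map_mem hS
  map_of_mem _ hd := hΦ.map_of_mem hS hd
  norm_le := hΦ.norm_le hS
  nonneg _ hx := hΦ.nonneg hx
  bimodule d hd e he x := by rw [(hΦ.diagonal_mul hS he _).2, (hΦ.diagonal_mul hS hd _).1]
  faithful _ hx := hΦ.faithful hS hx
  off_diagonal _ _ h := hΦ.map_matUnit hS h

end IsPinchLimit

theorem IsDiagonalExpectation.continuous {Φ : A →ₗ[ℂ] A} (h : IsDiagonalExpectation S Φ) :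
    Continuous Φ :=
  AddMonoidHomClass.continuous_of_bound Φ 1 fun x => by simpa using h.norm_le x

theorem IsDiagonalExpectation.unique (hS : IsCuntzFamily S) {Φ Ψ : A →ₗ[ℂ] A}
    (h : IsDiagonalExpectation S Φ) (h' : IsDiagonalExpectation S Ψ) : Φ = Ψ := by
  refine LinearMap.ext fun x => hS.dense_induction (p := fun x => Φ x = Ψ x)
    (isClosed_eq h.continuous h'.continuous) ?_ (by simp)
    (fun x y hx hy => by simp only [map_add, hx, hy])
    (fun c x hx => by simp only [map_smul, hx]) x
  intro μ ν
  by_cases hne : μ = ν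
  · subst hne
    rw [matUnit_self, h.map_of_mem _ (wordProj_mem_diagonal S μ),
      h'.map_of_mem _ (wordProj_mem_diagonal S μ)]
  · exact (h.off_diagonal μ ν hne).trans (h'.off_diagonal μ ν hne).symm

theorem IsCuntzFamily.existsUnique_isDiagonalExpectation [Nontrivial A] (hS : IsCuntzFamily S) :
    ∃! Φ : A →ₗ[ℂ] A, IsDiagonalExpectation S Φ := by
  obtain ⟨Φ, hΦ⟩ := hS.exists_linearMap_tendsto_pinch
  have hΦ' : IsPinchLimit S Φ := hΦ
  exact ⟨Φ, hΦ'.isDiagonalExpectation hS,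
    fun Ψ hΨ => hΨ.unique hS (hΦ'.isDiagonalExpectation hS)⟩

theorem IsCuntzFamily.isDiagonalExpectation_diagonalExpectation [Nontrivial A]
    (hS : IsCuntzFamily S) : IsDiagonalExpectation S (diagonalExpectation S) :=
  Classical.epsilon_spec hS.existsUnique_isDiagonalExpectation.exists

theorem IsCuntzFamily.isPinchLimit_diagonalExpectation [Nontrivial A]
    (hS : IsCuntzFamily S) : IsPinchLimit S (diagonalExpectation S) := by
  obtain ⟨Φ, hΦ⟩ := hS.exists_linearMap_tendsto_pinch
  have hΦ' : IsPinchLimit S Φ := hΦ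
  rwa [hS.isDiagonalExpectation_diagonalExpectation.unique hS (hΦ'.isDiagonalExpectation hS)]

/-- Every nonzero right ideal of the Cuntz algebra contains a nonzero projection. -/
theorem IsCuntzFamily.exists_isStarProjection_eq_mul [Nontrivial A] (hS : IsCuntzFamily S) {y : A}
    (hy : y ≠ 0) : ∃ p b : A, IsStarProjection p ∧ p ≠ 0 ∧ p = y * b := by
  obtain ⟨Φ, hΦ⟩ := hS.exists_linearMap_tendsto_pinch
  have hΦ' : IsPinchLimit S Φ := hΦ
  set δ := ‖Φ (star y * y)‖ with hδ
  have hδ0 : 0 < δ := norm_pos_iff.mpr fun h => hy (hΦ'.faithful hS h)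
  obtain ⟨K, y', hy', hlt⟩ := hS.exists_matSpan_norm_sub_lt (star y * y)
    (by positivity : 0 < δ / 4)
  obtain ⟨L, hL, hKL⟩ := (((hΦ (star y * y)).norm.eventually_const_lt (u := δ / 2)
    (by rw [← hδ]; linarith)).and (eventually_ge_atTop K)).exists
  -- The norm of a pinching is controlled by its blocks, so one block is large.
  obtain ⟨η, hη⟩ : ∃ η : List (Fin 2), δ / 2 <
      ‖star (wordIsometry S η * spike S L) * (star y * y) * (wordIsometry S η * spike S L)‖ := by
    by_contra! h
    exact hL.not_ge (hS.norm_pinch_le_of_forall (by positivity) fun η _ => h η)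
  -- The same block of the approximant is a scalar c. Then z lies within δ/4 of c and |c| > δ/4, so
  -- z is invertible.
  obtain ⟨c, hc⟩ := hS.exists_compress_eq_smul η (matSpan_mono S hKL hy')
  have hγ := hS.wordIsometry_mul_isometry η (hS.spike_isometry L)
  set γ := wordIsometry S η * spike S L
  set z := star γ * (star y * y) * γ with hz
  have hzc : ‖z - c • 1‖ < δ / 4 := by
    rw [← hc, hz, ← sub_mul, ← mul_sub]
    exact (norm_star_mul_mul_le hγ _).trans_lt hlt
  have hcn : δ / 4 < ‖c‖ := by
    have h1 : ‖z‖ ≤ ‖z - c • 1‖ + ‖c • (1 : A)‖ := by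
      simpa using norm_add_le (z - c • 1) (c • (1 : A))
    rw [norm_smul, CStarRing.norm_one, mul_one] at h1
    linarith
  have hc0 : c ≠ 0 := norm_pos_iff.mp (by linarith)
  have hzu : IsUnit z := by
    have h1 : ‖c⁻¹ • (c • 1 - z)‖ < 1 := by
      rw [norm_smul, norm_inv, norm_sub_rev, inv_mul_lt_iff₀ (by linarith)]
      linarith
    have h2 : z = algebraMap ℂ A c * (1 - c⁻¹ • (c • 1 - z)) := by
      rw [← Algebra.smul_def, smul_sub, smul_smul, mul_inv_cancel₀ hc0, one_smul]
      abel
    rw [h2]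
    exact ((IsUnit.mk0 c hc0).map (algebraMap ℂ A)).mul (isUnit_one_sub_of_norm_lt_one h1)
  have hzs : star z = z := by simp [hz, mul_assoc]
  obtain ⟨u, hu⟩ := hzu
  have hus : star (↑u⁻¹ : A) = ↑u⁻¹ := by
    have h1 : star u = u := Units.ext (by rw [Units.coe_star, hu, hzs])
    rw [← Units.coe_star, star_inv, h1]
  -- Since z = (yγ)*(yγ) is invertible, yγz⁻¹γ*y* is the range projection of yγ.
  refine ⟨y * (γ * ↑u⁻¹ * star γ * star y), γ * ↑u⁻¹ * star γ * star y, ⟨?_, ?_⟩, ?_, rfl⟩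
  · have h1 : y * (γ * ↑u⁻¹ * star γ * star y) * (y * (γ * ↑u⁻¹ * star γ * star y)) =
        y * (γ * ↑u⁻¹ * (z * ↑u⁻¹) * star γ * star y) := by simp only [hz, mul_assoc]
    rw [IsIdempotentElem, h1, ← hu, Units.mul_inv, mul_one]
  · rw [isSelfAdjoint_iff]
    simp only [star_mul, star_star, hus, mul_assoc]
  · intro h
    have h1 : star γ * star y * (y * (γ * ↑u⁻¹ * star γ * star y)) * (y * γ) =
        z * ↑u⁻¹ * z := by simp only [hz, mul_assoc]
    rw [h, ← hu, Units.mul_inv, one_mul, mul_zero, zero_mul] at h1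
    exact u.ne_zero h1.symm

/-- Modest scaling speaks of projections only. A non-zero y would give a non-zero projection in yA,
lying below the same α(P). -/
theorem IsModestlyScaling.eq_zero [Nontrivial A] {α : A →⋆ₐ[ℂ] A} (hα : IsModestlyScaling S α)
    (hS : IsCuntzFamily S) {ν : ℕ → List (Fin 2)} (hν : ∀ k, ν k ≠ []) {y : A}
    (hy : ∀ k, α (wordProj S ((List.range k).flatMap ν)) * y = y) : y = 0 := by
  by_contra h
  obtain ⟨p, b, hp, hp0, rfl⟩ := hS.exists_isStarProjection_eq_mul h
  refine hp0 (hα ν hν _ hp fun k => ?_)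
  rw [hp.le_iff_mul_eq_right ((hS.wordProj_isStarProjection _).map α), ← mul_assoc, hy]

end Faithful

end CuntzThompson

namespace CuntzThompson

/-! ### Unitaries given by tables, and their expectations. -/

section Tables

open Filter Topology

variable {A : Type*} [CStarAlgebra A] {S : Fin 2 → A}

/-- Finite sums of matrix units. -/
def matUnitSums (S : Fin 2 → A) : AddSubmonoid A :=
  AddSubmonoid.closure {x | ∃ μ ν, x = matUnit S μ ν}

theorem matUnit_mem_matUnitSums (S : Fin 2 → A) (μ ν : List (Fin 2)) :
    matUnit S μ ν ∈ matUnitSums S := AddSubmonoid.subset_closure ⟨μ, ν, rfl⟩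

theorem tableSum_mem_matUnitSums (S : Fin 2 → A) (J : Finset (List (Fin 2) × List (Fin 2))) :
    tableSum S J ∈ matUnitSums S :=
  sum_mem fun p _ => matUnit_mem_matUnitSums S p.1 p.2

/-- Products, hence powers, of table sums stay in this form, but a matrix unit may a priori be
repeated; lists allow for that where finite sets do not. -/
theorem exists_list_of_mem_matUnitSums {x : A} (hx : x ∈ matUnitSums S) :
    ∃ l : List (List (Fin 2) × List (Fin 2)), x = (l.map fun p => matUnit S p.1 p.2).sum := by
  induction hx using AddSubmonoid.closure_induction with
  | mem x h => obtain ⟨μ, ν, rfl⟩ := h; exact ⟨[(μ, ν)], by simp⟩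
  | zero => exact ⟨[], by simp⟩
  | add x y _ _ hx hy =>
    obtain ⟨l, rfl⟩ := hx
    obtain ⟨l', rfl⟩ := hy
    exact ⟨l ++ l', by simp⟩

namespace IsCuntzFamily

theorem mul_mem_matUnitSums (hS : IsCuntzFamily S) {x y : A} (hx : x ∈ matUnitSums S)
    (hy : y ∈ matUnitSums S) : x * y ∈ matUnitSums S := by
  induction hx using AddSubmonoid.closure_induction with
  | mem x h =>
    obtain ⟨μ, ν, rfl⟩ := h
    induction hy using AddSubmonoid.closure_induction with
    | mem y h =>
      obtain ⟨κ, l, rfl⟩ := h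
      rcases hS.matUnit_mul_matUnit μ ν κ l with h | ⟨μ', l', h⟩
      · rw [h]; exact zero_mem _
      · rw [h]; exact matUnit_mem_matUnitSums S _ _
    | zero => rw [mul_zero]; exact zero_mem _
    | add x y _ _ hx hy => rw [mul_add]; exact add_mem hx hy
  | zero => rw [zero_mul]; exact zero_mem _
  | add x y _ _ hx hy => rw [add_mul]; exact add_mem hx hy

theorem pow_mem_matUnitSums (hS : IsCuntzFamily S) {x : A} (hx : x ∈ matUnitSums S) (n : ℕ) :
    x ^ n ∈ matUnitSums S := by
  induction n with
  | zero => rw [pow_zero, ← matUnit_nil_nil S]; exact matUnit_mem_matUnitSums S _ _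
  | succ n ih => rw [pow_succ]; exact hS.mul_mem_matUnitSums ih hx

theorem star_wordIsometry_mul_eq_zero (hS : IsCuntzFamily S) {μ ν : List (Fin 2)}
    (h : wordProj S μ * wordProj S ν = 0) : star (wordIsometry S μ) * wordIsometry S ν = 0 := by
  have h1 : star (wordIsometry S μ) * (wordProj S μ * wordProj S ν) * wordIsometry S ν = 0 := by
    rw [h]; simp
  rw [← h1, mul_assoc, mul_assoc, hS.wordProj_mul_wordIsometry, ← mul_assoc]
  congr 1
  rw [← star_inj, star_mul, star_star, star_wordProj, hS.wordProj_mul_wordIsometry]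

end IsCuntzFamily

theorem star_sum_matUnit {ι : Type*} {s : Finset ι} {μ ν : ι → List (Fin 2)} {w : A}
    (hw : w = ∑ i ∈ s, matUnit S (μ i) (ν i)) : star w = ∑ i ∈ s, matUnit S (ν i) (μ i) := by
  rw [hw, star_sum]
  exact Finset.sum_congr rfl fun i _ => star_matUnit S _ _

theorem IsPinchLimit.map_table {Φ : A →ₗ[ℂ] A} (hΦ : IsPinchLimit S Φ) (hS : IsCuntzFamily S) {ι : Type*} {s : Finset ι}
    {μ ν : ι → List (Fin 2)} {w : A} (hw : w = ∑ i ∈ s, matUnit S (μ i) (ν i)) :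
    Φ w = ∑ i ∈ s with μ i = ν i, wordProj S (ν i) := by
  rw [hw, map_sum, Finset.sum_filter]
  refine Finset.sum_congr rfl fun i _ => ?_
  split_ifs with h
  · rw [h, matUnit_self, hΦ.map_wordProj hS]
  · exact hΦ.map_matUnit hS h

theorem IsPinchLimit.star_map_self {Φ : A →ₗ[ℂ] A} (hΦ : IsPinchLimit S Φ) (hS : IsCuntzFamily S) {w : A}
    (hw : w ∈ matUnitSums S) : star (Φ w) = Φ w := by
  obtain ⟨l, hl⟩ := exists_list_of_mem_matUnitSums hw
  have hl' : w = ∑ i : Fin l.length, matUnit S (l[i].1) (l[i].2) := by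
    rw [hl]
    exact (Fin.sum_univ_fun_getElem l fun p => matUnit S p.1 p.2).symm
  rw [hΦ.map_table hS hl', star_sum]
  exact Finset.sum_congr rfl fun i _ => star_wordProj S _

variable [PartialOrder A] [StarOrderedRing A] {Φ : A →ₗ[ℂ] A}

theorem IsPinchLimit.matUnit_mul_nonneg (hΦ : IsPinchLimit S Φ) (hS : IsCuntzFamily S)
    (μ ν κ l : List (Fin 2)) : 0 ≤ Φ (matUnit S μ ν * matUnit S κ l) := by
  rcases hS.matUnit_mul_matUnit μ ν κ l with h | ⟨μ', l', h⟩
  · rw [h, map_zero]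
  · rw [h]
    by_cases hne : μ' = l'
    · subst hne
      rw [matUnit_self, hΦ.map_wordProj hS]
      exact (hS.wordProj_isStarProjection _).nonneg
    · rw [hΦ.map_matUnit hS hne]

namespace IsCuntzFamily

variable {ι : Type*} {s : Finset ι} {μ ν : ι → List (Fin 2)} {w : A}

/-- Expand w*w = 1 into products of matrix units and apply Φ. Every term has positive expectation,
and the terms with equal indices contribute exactly the P_{ν_i}. Nothing about the table is
presupposed. -/
theorem sum_wordProj_le_one (hS : IsCuntzFamily S) (hwu : w ∈ unitary A)
    (hw : w = ∑ i ∈ s, matUnit S (μ i) (ν i)) : ∑ i ∈ s, wordProj S (ν i) ≤ 1 := by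
  obtain ⟨Φ, hΦ⟩ := hS.exists_linearMap_tendsto_pinch
  have hΦ' : IsPinchLimit S Φ := hΦ
  have h : (1 : A) = ∑ i ∈ s, ∑ j ∈ s,
      Φ (matUnit S (ν i) (μ i) * matUnit S (μ j) (ν j)) := by
    have h1 : star w * w = 1 := Unitary.star_mul_self_of_mem hwu
    rw [star_sum_matUnit hw, hw, Finset.sum_mul] at h1
    simp only [Finset.mul_sum] at h1
    simpa [map_sum, hΦ'.map_one hS] using (congrArg Φ h1).symm
  rw [h]
  refine Finset.sum_le_sum fun i hi => ?_
  have h2 : wordProj S (ν i) = Φ (matUnit S (ν i) (μ i) * matUnit S (μ i) (ν i)) := by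
    have : matUnit S (ν i) (μ i) * matUnit S (μ i) (ν i) = wordProj S (ν i) := by
      rw [matUnit, matUnit, mul_assoc, ← mul_assoc (star _), hS.wordIsometry_isometry, one_mul,
        wordProj]
    rw [this, hΦ'.map_wordProj hS]
  rw [h2]
  exact Finset.single_le_sum (f := fun j => Φ (matUnit S (ν i) (μ i) * matUnit S (μ j) (ν j)))
    (fun j _ => hΦ'.matUnit_mul_nonneg hS _ _ _ _) hi

theorem wordProj_orthogonal (hS : IsCuntzFamily S) (hwu : w ∈ unitary A)
    (hw : w = ∑ i ∈ s, matUnit S (μ i) (ν i)) {i j : ι} (hi : i ∈ s) (hj : j ∈ s) (hij : i ≠ j) :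
    wordProj S (ν i) * wordProj S (ν j) = 0 := by
  classical
  have h1 : wordProj S (ν i) + wordProj S (ν j) ≤ 1 := by
    refine le_trans ?_ (hS.sum_wordProj_le_one hwu hw)
    rw [← Finset.sum_pair (f := fun i => wordProj S (ν i)) hij]
    exact Finset.sum_le_sum_of_subset_of_nonneg (by simp [Finset.insert_subset_iff, hi, hj])
      fun k _ _ => (hS.wordProj_isStarProjection _).nonneg
  have h2 := ((hS.wordProj_isStarProjection (ν i)).le_iff_mul_eq_left
    (hS.wordProj_isStarProjection (ν j)).one_sub).mp (le_sub_right_of_add_le h1)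
  rwa [mul_sub, mul_one, sub_eq_self] at h2

theorem wordProj_orthogonal_left (hS : IsCuntzFamily S) (hwu : w ∈ unitary A)
    (hw : w = ∑ i ∈ s, matUnit S (μ i) (ν i)) {i j : ι} (hi : i ∈ s) (hj : j ∈ s) (hij : i ≠ j) :
    wordProj S (μ i) * wordProj S (μ j) = 0 :=
  hS.wordProj_orthogonal (Unitary.star_mem hwu) (star_sum_matUnit hw) hi hj hij

theorem table_mul_wordIsometry (hS : IsCuntzFamily S) (hwu : w ∈ unitary A)
    (hw : w = ∑ i ∈ s, matUnit S (μ i) (ν i)) {i : ι} (hi : i ∈ s) :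
    w * wordIsometry S (ν i) = wordIsometry S (μ i) := by
  conv_lhs => rw [hw]
  rw [Finset.sum_mul, Finset.sum_eq_single i]
  · rw [matUnit, mul_assoc, hS.wordIsometry_isometry, mul_one]
  · intro j hj hji
    rw [matUnit, mul_assoc,
      hS.star_wordIsometry_mul_eq_zero (hS.wordProj_orthogonal hwu hw hj hi hji), mul_zero]
  · exact fun h => absurd hi h

theorem table_mul_wordProj_mul_star (hS : IsCuntzFamily S) (hwu : w ∈ unitary A)
    (hw : w = ∑ i ∈ s, matUnit S (μ i) (ν i)) {i : ι} (hi : i ∈ s) :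
    w * wordProj S (ν i) * star w = wordProj S (μ i) := by
  rw [wordProj, ← mul_assoc, mul_assoc _ (star _) (star w), ← star_mul,
    hS.table_mul_wordIsometry hwu hw hi, wordProj]

theorem sum_wordProj_eq_one (hS : IsCuntzFamily S) (hwu : w ∈ unitary A)
    (hw : w = ∑ i ∈ s, matUnit S (μ i) (ν i)) : ∑ i ∈ s, wordProj S (ν i) = 1 := by
  rw [← Unitary.star_mul_self_of_mem hwu]
  conv_rhs => rw [hw, Finset.mul_sum]
  refine Finset.sum_congr rfl fun i hi => ?_
  have := hS.table_mul_wordIsometry (Unitary.star_mem hwu) (star_sum_matUnit hw) hi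
  rw [← hw, matUnit, ← mul_assoc, this, wordProj]

theorem sum_wordProj_left_eq_one (hS : IsCuntzFamily S) (hwu : w ∈ unitary A)
    (hw : w = ∑ i ∈ s, matUnit S (μ i) (ν i)) : ∑ i ∈ s, wordProj S (μ i) = 1 :=
  hS.sum_wordProj_eq_one (Unitary.star_mem hwu) (star_sum_matUnit hw)

end IsCuntzFamily

namespace IsPinchLimit

/-- Φ keeps precisely the pairs with equal words, and on those cylinders `w` acts as the identity.
-/
theorem mul_map_self (hΦ : IsPinchLimit S Φ) (hS : IsCuntzFamily S) {w : A} (hwu : w ∈ unitary A)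
    (hw : w ∈ matUnitSums S) : w * Φ w = Φ w := by
  obtain ⟨l, hl⟩ := exists_list_of_mem_matUnitSums hw
  have hl' : w = ∑ i : Fin l.length, matUnit S (l[i].1) (l[i].2) := by
    rw [hl]
    exact (Fin.sum_univ_fun_getElem l fun p => matUnit S p.1 p.2).symm
  rw [hΦ.map_table hS hl', Finset.mul_sum]
  refine Finset.sum_congr rfl fun i hi => ?_
  rw [Finset.mem_filter] at hi
  rw [wordProj, ← mul_assoc, hS.table_mul_wordIsometry hwu hl' (Finset.mem_univ i), hi.2]

theorem isStarProjection_map (hΦ : IsPinchLimit S Φ) (hS : IsCuntzFamily S) {w : A}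
    (hwu : w ∈ unitary A) (hw : w ∈ matUnitSums S) : IsStarProjection (Φ w) where
  isIdempotentElem := by
    have h := congrArg Φ (hΦ.mul_map_self hS hwu hw)
    rwa [(hΦ.diagonal_mul hS (hΦ.map_mem hS w) w).2, hΦ.map_of_mem hS (hΦ.map_mem hS w)] at h
  isSelfAdjoint := hΦ.star_map_self hS hw

theorem map_mul_self (hΦ : IsPinchLimit S Φ) (hS : IsCuntzFamily S) {w : A} (hwu : w ∈ unitary A)
    (hw : w ∈ matUnitSums S) : Φ w * w = Φ w := by
  have h : star w * Φ w = Φ w := by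
    conv_lhs => rw [← hΦ.mul_map_self hS hwu hw]
    rw [← mul_assoc, Unitary.star_mul_self_of_mem hwu, one_mul]
  rw [← star_inj, star_mul, hΦ.star_map_self hS hw, h]

/-- If all powers of a unitary `v` have vanishing expectation under the projection `d`, then `v`
has no fixed vectors under `d`. -/
theorem eq_zero_of_mul_eq [Nontrivial A] (hΦ : IsPinchLimit S Φ) (hS : IsCuntzFamily S) {v d y : A}
    (hv : v ∈ unitary A) (hd : IsStarProjection d) (hdD : d ∈ diagonal S) (hdv : Commute d v)
    (h1 : ∀ n, n ≠ 0 → d * Φ (v ^ n) = 0) (h2 : ∀ n, n ≠ 0 → Φ (v ^ n) * d = 0)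
    (hvy : v * y = y) (hdy : d * y = y) : y = 0 := by
  have hpow : ∀ n, v ^ n * y = y := by
    intro n
    induction n with
    | zero => simp
    | succ n ih => rw [pow_succ, mul_assoc, hvy, ih]
  have hvs : ∀ m n : ℕ, v ^ (n + m) * star (v ^ n) = v ^ m := by
    intro m n
    rw [add_comm, pow_add, mul_assoc, Unitary.mul_star_self_of_mem (pow_mem hv n), mul_one]
  set z := y * star y with hz
  have hdz : d * z * d = z := by
    have : star y * d = star y := by
      rw [← star_inj, star_mul, star_star, hd.isSelfAdjoint.star_eq, hdy]
    rw [hz, ← mul_assoc, hdy, mul_assoc, this]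
  -- A mean ergodic estimate: T multiplies y by N, so TdzdT* = N²z, whereas the expectation of TdT*
  -- grows only like N because all cross terms vanish.
  have key : ∀ N : ℕ, N * ‖Φ z‖ ≤ ‖z‖ * ‖d‖ := by
    intro N
    rcases Nat.eq_zero_or_pos N with rfl | hN
    · simpa using mul_nonneg (norm_nonneg z) (norm_nonneg d)
    set T := ∑ n ∈ Finset.range N, v ^ n with hT
    have hTy : T * y = (N : ℂ) • y := by
      simp [hT, Finset.sum_mul, hpow, Nat.cast_smul_eq_nsmul]
    have hTz : ((N : ℂ) * N) • z = T * d * z * star (T * d) := by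
      have : T * d * z * star (T * d) = (T * y) * star (T * y) := by
        rw [star_mul, hd.isSelfAdjoint.star_eq, ← mul_assoc, mul_assoc T, mul_assoc T, hdz, hz,
          star_mul]
        simp only [mul_assoc]
      rw [this, hTy]
      simp [hz, mul_smul]
    have hTd : Φ (T * d * star (T * d)) = (N : ℂ) • d := by
      have e1 : T * d * star (T * d) = ∑ m ∈ Finset.range N, ∑ n ∈ Finset.range N,
          d * (v ^ m * star (v ^ n)) := by
        have hc : Commute d T := Commute.sum_right _ _ _ fun n _ => hdv.pow_right n
        rw [star_mul, hd.isSelfAdjoint.star_eq, mul_assoc, ← mul_assoc d, hd.isIdempotentElem.eq,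
          ← mul_assoc, ← hc.eq, mul_assoc, hT, star_sum, Finset.sum_mul, Finset.mul_sum]
        simp only [Finset.mul_sum]
      have e2 : ∀ m n : ℕ, Φ (d * (v ^ m * star (v ^ n))) = if m = n then d else 0 := by
        intro m n
        rw [(hΦ.diagonal_mul hS hdD _).1]
        rcases lt_trichotomy m n with h | h | h
        · obtain ⟨k, rfl⟩ := Nat.exists_eq_add_of_lt h
          have : v ^ m * star (v ^ (m + k + 1)) = star (v ^ (k + 1)) := by
            rw [← star_inj, star_mul, star_star, star_star, add_assoc, hvs]
          rw [this, hΦ.map_star, if_neg h.ne, ← star_inj, star_mul, star_star,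
            hd.isSelfAdjoint.star_eq, h2 _ (by omega), star_zero]
        · subst h
          rw [Unitary.mul_star_self_of_mem (pow_mem hv m), hΦ.map_one hS, mul_one, if_pos rfl]
        · obtain ⟨k, rfl⟩ := Nat.exists_eq_add_of_lt h
          rw [add_assoc, hvs, h1 _ (by omega), if_neg (by omega)]
      rw [e1, map_sum]
      simp only [map_sum, e2]
      simp +contextual [Finset.sum_ite_eq, Nat.cast_smul_eq_nsmul]
    have hle : ((N : ℂ) * N) • Φ z ≤ ‖z‖ • ((N : ℂ) • d) := by
      have h3 : T * d * z * star (T * d) ≤ ‖z‖ • (T * d * star (T * d)) :=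
        CStarAlgebra.star_right_conjugate_le_norm_smul (IsSelfAdjoint.mul_star_self y)
      have h4 := hΦ.nonneg (sub_nonneg.mpr h3)
      have h5 : Φ (‖z‖ • (T * d * star (T * d))) = ‖z‖ • Φ (T * d * star (T * d)) := by
        rw [← Complex.coe_smul, map_smul, Complex.coe_smul]
      rwa [map_sub, h5, hTd, ← hTz, map_smul, sub_nonneg] at h4
    have hnn : 0 ≤ ((N : ℂ) * N) • Φ z := by
      rw [← map_smul, hTz]
      exact hΦ.nonneg (star_right_conjugate_nonneg (mul_star_self_nonneg y) _)
    have h6 := CStarAlgebra.norm_le_norm_of_nonneg_of_le hnn hle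
    rw [norm_smul, norm_smul, norm_smul, norm_mul, Complex.norm_natCast, Real.norm_eq_abs,
      abs_norm] at h6
    have hN' : (0 : ℝ) < N := by exact_mod_cast hN
    refine le_of_mul_le_mul_left ?_ hN'
    linarith
  have hΦz : Φ z = 0 := by
    by_contra h
    have h3 : 0 < ‖Φ z‖ := norm_pos_iff.mpr h
    obtain ⟨N, hN⟩ := exists_nat_gt (‖z‖ * ‖d‖ / ‖Φ z‖)
    rw [div_lt_iff₀ h3] at hN
    exact absurd (key N) hN.not_ge
  have := hΦ.faithful hS (x := star y) (by rwa [star_star])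
  simpa using this

end IsPinchLimit

end Tables

end CuntzThompson

/-! ### Prefixes, lexicographic order, and the dynamics of F. -/

namespace CuntzThompson

/-- The extensions of a word form an interval of the lexicographic order. -/
theorem prefix_of_not_lt_of_not_lt {β : Type*} [LinearOrder β] {a b c : List β} (hab : ¬ b < a)
    (hbc : ¬ c < b) (h : a <+: c) : a <+: b := by
  induction a generalizing b c with
  | nil => exact List.nil_prefix
  | cons i a ih =>
    obtain ⟨r, rfl⟩ := h
    cases b with
    | nil => exact absurd (List.nil_lt_cons i a) hab
    | cons j b =>
      rw [List.cons_append, List.cons_lt_cons_iff] at hbc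
      rw [List.cons_lt_cons_iff] at hab
      push Not at hab hbc
      obtain rfl : i = j := le_antisymm hab.1 hbc.1
      rw [List.cons_prefix_cons]
      exact ⟨rfl, ih (not_lt.mpr (hab.2 rfl)) (not_lt.mpr (hbc.2 rfl)) ⟨r, rfl⟩⟩

theorem not_lt_of_prefix {β : Type*} [LinearOrder β] {a b : List β} (h : a <+: b) : ¬ b < a := by
  obtain ⟨r, rfl⟩ := h
  induction a with
  | nil => simp
  | cons i a ih => simpa [List.cons_lt_cons_iff] using ih

theorem flatMap_range_succ_ite {β : Type*} (ν ρ : List β) (k : ℕ) :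
    (List.range (k + 1)).flatMap (fun k => if k = 0 then ν ++ ρ else ρ) =
      ν ++ (List.replicate (k + 1) ρ).flatten := by
  induction k with
  | zero => simp
  | succ k ih =>
    rw [List.range_succ, List.flatMap_append, ih, List.replicate_succ' (n := k + 1)]
    simp

section Dynamics

variable {A : Type*} [CStarAlgebra A] {S : Fin 2 → A}

theorem wordIsometry_flatten_replicate (S : Fin 2 → A) (k : ℕ) (ρ : List (Fin 2)) :
    wordIsometry S (List.replicate k ρ).flatten = wordIsometry S ρ ^ k := by
  induction k with
  | zero => simp [wordIsometry_nil]
  | succ k ih => rw [List.replicate_succ, List.flatten_cons, wordIsometry_append, ih, pow_succ']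

namespace IsCuntzFamily

theorem not_prefix_of_wordProj_mul [Nontrivial A] (hS : IsCuntzFamily S) {a b : List (Fin 2)}
    (h : wordProj S a * wordProj S b = 0) : ¬ a <+: b := by
  rintro ⟨r, rfl⟩
  apply hS.wordProj_ne_zero (a ++ r)
  rw [← hS.wordProj_append_mul a r, ← star_inj, star_mul, star_wordProj, star_wordProj, h,
    star_zero]

theorem isStarProjection_sum (hS : IsCuntzFamily S) {ι : Type*} {t : Finset ι}
    {κ : ι → List (Fin 2)}
    (h : ∀ i ∈ t, ∀ j ∈ t, i ≠ j → wordProj S (κ i) * wordProj S (κ j) = 0) :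
    IsStarProjection (∑ i ∈ t, wordProj S (κ i)) := by
  classical
  induction t using Finset.induction_on with
  | empty => simp [IsStarProjection.zero]
  | insert a t ha ih =>
    rw [Finset.sum_insert ha]
    refine (hS.wordProj_isStarProjection _).add (ih fun i hi j hj =>
      h i (Finset.mem_insert_of_mem hi) j (Finset.mem_insert_of_mem hj)) ?_
    rw [Finset.mul_sum]
    exact Finset.sum_eq_zero fun j hj => h a (Finset.mem_insert_self a t) j
      (Finset.mem_insert_of_mem hj) fun e => ha (e ▸ hj)

end IsCuntzFamily

variable [PartialOrder A] [StarOrderedRing A]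

/-- A vector fixed by `α u` is annihilated by `α e` if `u` moves some `g` up by `e`. -/
theorem map_mul_eq_zero_of_add_le (α : A →⋆ₐ[ℂ] A) {u g e y : A} (hu : u ∈ unitary A)
    (he : IsStarProjection e) (h : g + e ≤ u * g * star u) (hy : α u * y = y) : α e * y = 0 := by
  have h1 : α g + α e ≤ α u * α g * star (α u) := by
    have := OrderHomClass.mono α h
    simpa [map_star] using this
  have h2 := star_left_conjugate_le_conjugate h1 y
  have h3 : star y * α u = star y := by
    have h4 : star (α u) * y = y := by
      conv_lhs => rw [← hy]
      rw [← mul_assoc, ← map_star, ← map_mul, Unitary.star_mul_self_of_mem hu, map_one, one_mul]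
    rw [← star_inj, star_mul, star_star, h4]
  have h4 : star (α u) * y = y := by simpa using congrArg star h3
  have h5 : star y * (α u * α g * star (α u)) * y = star y * α g * y := by
    rw [mul_assoc, mul_assoc (α u * α g), h4, ← mul_assoc, ← mul_assoc, h3]
  rw [h5, mul_add, add_mul, add_le_iff_nonpos_right] at h2
  have h6 : star (α e * y) * (α e * y) = star y * α e * y := by
    rw [star_mul, (he.map α).isSelfAdjoint.star_eq, mul_assoc, ← mul_assoc (α e),
      (he.map α).isIdempotentElem.eq, mul_assoc]
  rw [← CStarRing.star_mul_self_eq_zero_iff]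
  exact le_antisymm (h6 ▸ h2) (star_mul_self_nonneg _)

theorem add_le_conj_pow {w g e : A} (he : 0 ≤ e) (h : g + e ≤ w * g * star w) {n : ℕ}
    (hn : n ≠ 0) : g + e ≤ w ^ n * g * star (w ^ n) := by
  induction n, Nat.one_le_iff_ne_zero.mpr hn using Nat.le_induction with
  | base => simpa using h
  | succ n _ ih =>
    have h1 : g ≤ w ^ n * g * star (w ^ n) := (le_add_of_nonneg_right he).trans (ih (by omega))
    refine h.trans ((star_right_conjugate_le_conjugate h1 w).trans_eq ?_)
    rw [pow_succ', star_mul]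
    simp only [mul_assoc]

/-- Here u maps the cylinder of νρᵏ onto that of νρᵏ⁺¹. A fixed vector is killed by the differences,
so its component in the cylinder of ν lies in all of them. -/
theorem IsModestlyScaling.map_wordProj_mul_eq_zero [Nontrivial A] {α : A →⋆ₐ[ℂ] A}
    (hα : IsModestlyScaling S α) (hS : IsCuntzFamily S) {u y : A} (hu : u ∈ unitary A)
    {ν ρ : List (Fin 2)} (hρ : ρ ≠ []) (h : u * wordIsometry S ν = wordIsometry S (ν ++ ρ))
    (hy : α u * y = y) : α (wordProj S ν) * y = 0 := by
  let κ : ℕ → List (Fin 2) := fun k => ν ++ (List.replicate k ρ).flatten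
  have hκ : ∀ k, κ (k + 1) = κ k ++ ρ := fun k => by
    simp [κ, List.replicate_succ']
  have hstep : ∀ k, u * wordProj S (κ k) * star u = wordProj S (κ (k + 1)) := by
    intro k
    have : u * wordIsometry S (κ k) = wordIsometry S (κ (k + 1)) := by
      simp only [κ]
      rw [wordIsometry_append, ← mul_assoc, h, wordIsometry_append, wordIsometry_append,
        wordIsometry_flatten_replicate, wordIsometry_flatten_replicate, pow_succ', mul_assoc]
    rw [wordProj, wordProj, ← this, star_mul]
    simp only [mul_assoc]
  have hk : ∀ k, α (wordProj S (κ k)) * y = α (wordProj S ν) * y := by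
    intro k
    induction k with
    | zero => simp [κ]
    | succ k ih =>
      rw [← ih]
      have he : IsStarProjection (wordProj S (κ k) - wordProj S (κ (k + 1))) := by
        refine (hS.wordProj_isStarProjection _).sub_of_mul_eq_left
          (hS.wordProj_isStarProjection _) ?_
        rw [hκ]
        exact hS.wordProj_append_mul _ _
      -- The cylinder shrinks under u, so its negative grows by the difference, with equality.
      have h1 := map_mul_eq_zero_of_add_le α (g := -wordProj S (κ k)) hu he (by
        rw [mul_neg, neg_mul, hstep]
        exact le_of_eq (by abel)) hy
      rw [map_sub, sub_mul, sub_eq_zero] at h1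
      exact h1.symm
  -- The word ν may be empty, so it is merged with the first ρ to keep every term non-empty.
  refine hα.eq_zero hS (ν := fun k => if k = 0 then ν ++ ρ else ρ) (fun k => ?_) fun k => ?_
  · split_ifs <;> simp [hρ]
  · cases k with
    | zero => simp [wordProj_nil]
    | succ k =>
      rw [flatMap_range_succ_ite]
      change α (wordProj S (κ (k + 1))) * _ = _
      rw [← mul_assoc, ← map_mul, hS.wordProj_append_mul, hk]

namespace IsCuntzFamily

/-- An order preserving table which moves the cylinder of `ν i` to the right moves the projection
onto everything to the left of that cylinder up by at least `P_{ν i}`. -/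
theorem exists_add_wordProj_le [Nontrivial A] (hS : IsCuntzFamily S) {ι : Type*} {s : Finset ι}
    {μ ν : ι → List (Fin 2)} {w : A} (hwu : w ∈ unitary A)
    (hw : w = ∑ i ∈ s, matUnit S (μ i) (ν i))
    (hord : ∀ i ∈ s, ∀ j ∈ s, ν i < ν j → μ i < μ j) {i : ι} (hi : i ∈ s) (hlt : ν i < μ i)
    (hpre : ¬ ν i <+: μ i) : ∃ g, g + wordProj S (ν i) ≤ w * g * star w := by
  classical
  set t := {j ∈ s | ν j < ν i} with ht
  have hit : i ∉ t := by simp [ht]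
  have hts : insert i t ⊆ s := Finset.insert_subset hi (Finset.filter_subset _ _)
  refine ⟨∑ j ∈ t, wordProj S (ν j), ?_⟩
  have hconj : w * (∑ j ∈ t, wordProj S (ν j)) * star w = ∑ j ∈ t, wordProj S (μ j) := by
    rw [Finset.mul_sum, Finset.sum_mul]
    exact Finset.sum_congr rfl fun j hj =>
      hS.table_mul_wordProj_mul_star hwu hw (Finset.mem_of_mem_filter j hj)
  rw [hconj, add_comm, ← Finset.sum_insert (f := fun j => wordProj S (ν j)) hit]
  have hG : IsStarProjection (∑ j ∈ insert i t, wordProj S (ν j)) :=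
    hS.isStarProjection_sum fun j hj k hk hjk =>
      hS.wordProj_orthogonal hwu hw (hts hj) (hts hk) hjk
  have hH : IsStarProjection (∑ j ∈ t, wordProj S (μ j)) :=
    hS.isStarProjection_sum fun j hj k hk hjk => hS.wordProj_orthogonal_left hwu hw
      (Finset.mem_of_mem_filter j hj) (Finset.mem_of_mem_filter k hk) hjk
  rw [hG.le_iff_mul_eq_right hH]
  -- The complement of w g w* consists of the cylinders μ_q with μ_q ≥ μ_i > ν_i. It remains to see
  -- that these are disjoint from ν_i and from all ν_r to its left.
  have hsum := hS.sum_wordProj_left_eq_one hwu hw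
  rw [← Finset.sum_filter_add_sum_filter_not s (fun j => ν j < ν i), ← eq_sub_iff_add_eq] at hsum
  rw [hsum, sub_mul, one_mul, sub_eq_self, Finset.sum_mul]
  refine Finset.sum_eq_zero fun q hq => ?_
  rw [Finset.mul_sum]
  refine Finset.sum_eq_zero fun r hr => ?_
  rw [Finset.mem_filter] at hq
  have hrs := hts hr
  have hr' : ¬ ν i < ν r := by
    rcases Finset.mem_insert.mp hr with rfl | hr
    · exact lt_irrefl _
    · exact (Finset.mem_filter.mp hr).2.not_gt
  have hq' : ¬ μ q < μ i := by
    by_cases hqi : q = i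
    · subst hqi; exact lt_irrefl _
    · rcases lt_trichotomy (ν q) (ν i) with h | h | h
      · exact absurd h hq.2
      · have := hS.wordProj_orthogonal hwu hw hq.1 hi hqi
        exact absurd (h ▸ List.prefix_rfl) (hS.not_prefix_of_wordProj_mul this)
      · exact (hord i hi q hq.1 h).not_gt
  have hiq : ν i < μ q := hlt.trans_le (not_lt.mp hq')
  refine hS.wordProj_mul_wordProj_of_not_prefix (fun h => ?_) (fun h => ?_)
  · exact not_lt_of_prefix h ((not_lt.mp hr').trans_lt hiq)
  · by_cases hri : r = i
    · subst hri
      exact hpre (prefix_of_not_lt_of_not_lt hlt.not_gt hq' h)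
    · exact hS.not_prefix_of_wordProj_mul (hS.wordProj_orthogonal hwu hw hrs hi hri)
        (prefix_of_not_lt_of_not_lt hr' hiq.not_gt h)

end IsCuntzFamily

/-- Outside `α (Φ w)`, the image of `w` in Thompson's group `F` has no periodic vectors. -/
theorem IsModestlyScaling.eq_zero_of_mem_thompsonF [Nontrivial A] {α : A →⋆ₐ[ℂ] A}
    (hα : IsModestlyScaling S α) (hS : IsCuntzFamily S) {Φ : A →ₗ[ℂ] A} (hΦ : IsPinchLimit S Φ)
    {w y : A} (hw : w ∈ thompsonF S) {n : ℕ} (hn : n ≠ 0) (hy : α (w ^ n) * y = y)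
    (hy0 : α (Φ w) * y = 0) : y = 0 := by
  obtain ⟨hwu, J, hJ, hord⟩ := hw
  have hJ' : w = ∑ p ∈ J, matUnit S p.1 p.2 := hJ
  have hwu' := Unitary.star_mem hwu
  have hord' : ∀ p ∈ J, ∀ q ∈ J, p.2 < q.2 → p.1 < q.1 := by
    intro p hp q hq hpq
    rcases lt_trichotomy p.1 q.1 with h | h | h
    · exact h
    · have hne : p ≠ q := fun e => (e ▸ hpq).false
      have := hS.wordProj_orthogonal_left hwu hJ' hp hq hne
      exact absurd (h ▸ List.prefix_rfl) (hS.not_prefix_of_wordProj_mul this)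
    · exact absurd (hord q hq p hp h) hpq.not_gt
  have hys : α (star w ^ n) * y = y := by
    conv_lhs => rw [← hy]
    rw [← mul_assoc, ← map_mul, ← star_pow, Unitary.star_mul_self_of_mem (pow_mem hwu n), map_one,
      one_mul]
  have hpow : ∀ {u : A} {ν ρ : List (Fin 2)}, u * wordIsometry S ν = wordIsometry S (ν ++ ρ) →
      u ^ n * wordIsometry S ν = wordIsometry S (ν ++ (List.replicate n ρ).flatten) := by
    intro u ν ρ h
    rw [wordIsometry_append, wordIsometry_flatten_replicate]
    clear hy hn hys
    induction n with
    | zero => simp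
    | succ n ih =>
      rw [pow_succ', mul_assoc, ih, ← mul_assoc, h, wordIsometry_append, pow_succ', mul_assoc]
  have hflat : ∀ {ρ : List (Fin 2)}, ρ ≠ [] → (List.replicate n ρ).flatten ≠ [] := by
    intro ρ hρ
    simp [hn, hρ]
  -- The cases: equal words, a cylinder shrunk by `w`, one expanded by `w` (treated through the
  -- inverse), and incomparable words moved right or left.
  have key : ∀ p ∈ J, α (wordProj S p.2) * y = 0 := by
    intro p hp
    have hmul := hS.table_mul_wordIsometry hwu hJ' hp
    have hmul' := hS.table_mul_wordIsometry hwu' (star_sum_matUnit hJ') hp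
    by_cases h1 : p.2 <+: p.1
    · obtain ⟨ρ, hρ⟩ := h1
      by_cases hρ0 : ρ = []
      · subst hρ0
        rw [List.append_nil] at hρ
        rw [← hρ] at hmul'
        have h2 : wordProj S p.2 * w = wordProj S p.2 := by
          rw [wordProj, mul_assoc]
          congr 1
          rw [← star_inj, star_mul, star_star, hmul']
        have h3 := hΦ.wordProj_mul hS p.2 w
        rw [h2, hΦ.map_wordProj hS] at h3
        rw [h3, map_mul, mul_assoc, hy0, mul_zero]
      · exact hα.map_wordProj_mul_eq_zero hS (pow_mem hwu n) (hflat hρ0)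
          (hpow (by rw [hmul, hρ])) hy
    by_cases h2 : p.1 <+: p.2
    · obtain ⟨ρ, hρ⟩ := h2
      have hρ0 : ρ ≠ [] := by
        rintro rfl
        exact h1 (by rw [← hρ, List.append_nil])
      have h3 := hα.map_wordProj_mul_eq_zero hS (pow_mem hwu' n) (hflat hρ0)
          (hpow (by rw [hmul', hρ])) hys
      rw [← hρ, ← hS.wordProj_append_mul, map_mul, mul_assoc, h3, mul_zero]
    · have hproj := hS.wordProj_isStarProjection p.2
      rcases lt_trichotomy p.1 p.2 with h3 | h3 | h3
      · obtain ⟨g, hg⟩ := hS.exists_add_wordProj_le hwu' (star_sum_matUnit hJ') hord hp h3 h2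
        -- The inequality for the inverse concerns P of `p.1`; one further conjugation turns it into
        -- P of `p.2`.
        have h4 := star_right_conjugate_le_conjugate hg (star w)
        rw [mul_add, add_mul,
          hS.table_mul_wordProj_mul_star hwu' (star_sum_matUnit hJ') hp] at h4
        exact map_mul_eq_zero_of_add_le α (pow_mem hwu' n) hproj
          (add_le_conj_pow hproj.nonneg h4 hn) hys
      · exact absurd (h3 ▸ List.prefix_rfl) h1
      · obtain ⟨g, hg⟩ := hS.exists_add_wordProj_le hwu hJ' hord' hp h3 h1
        exact map_mul_eq_zero_of_add_le α (pow_mem hwu n) hproj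
          (add_le_conj_pow hproj.nonneg hg hn) hy
  have h1 : α 1 * y = 0 := by
    rw [← hS.sum_wordProj_eq_one hwu hJ', map_sum, Finset.sum_mul]
    exact Finset.sum_eq_zero key
  simpa using h1

/-- A modestly scaling endomorphism which maps `F` into `V` intertwines the expectations of the
elements of `F`. -/
theorem IsModestlyScaling.map_expectation [Nontrivial A] {α : A →⋆ₐ[ℂ] A}
    (hα : IsModestlyScaling S α) (hS : IsCuntzFamily S) {Φ : A →ₗ[ℂ] A} (hΦ : IsPinchLimit S Φ)
    {w : A} (hw : w ∈ thompsonF S) (hαw : α w ∈ thompsonV S) : α (Φ w) = Φ (α w) := by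
  have hwu := hw.1
  have hws : w ∈ matUnitSums S := by
    obtain ⟨-, J, rfl, -⟩ := hw
    exact tableSum_mem_matUnitSums S J
  obtain ⟨hvu, J, hJ⟩ := hαw
  have hvs : α w ∈ matUnitSums S := hJ ▸ tableSum_mem_matUnitSums S J
  set v := α w with hv
  set q := α (Φ w) with hq
  have hvq : v * q = q := by rw [hv, hq, ← map_mul, hΦ.mul_map_self hS hwu hws]
  have hqv : q * v = q := by rw [hv, hq, ← map_mul, hΦ.map_mul_self hS hwu hws]
  have hqp : IsStarProjection q := (hΦ.isStarProjection_map hS hwu hws).map α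
  have hvnq : ∀ n : ℕ, v ^ n * q = q := by
    intro n
    induction n with
    | zero => simp
    | succ n ih => rw [pow_succ, mul_assoc, hvq, ih]
  -- The vector (1-q)Φ(vⁿ) is fixed by vⁿ and killed by q, so it vanishes.
  have hn : ∀ n : ℕ, n ≠ 0 → q * Φ (v ^ n) = Φ (v ^ n) := by
    intro n hn
    have h1 : α (w ^ n) = v ^ n := map_pow α w n
    have h2 := hα.eq_zero_of_mem_thompsonF hS hΦ hw (y := Φ (v ^ n) - q * Φ (v ^ n)) hn
      (by rw [h1, mul_sub, hΦ.mul_map_self hS (pow_mem hvu n) (hS.pow_mem_matUnitSums hvs n),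
        ← mul_assoc, hvnq])
      (by rw [← hq, mul_sub, ← mul_assoc, hqp.isIdempotentElem.eq, sub_self])
    exact (sub_eq_zero.mp h2).symm
  -- Lying under q, Φ(vⁿ) is fixed by v; applying Φ to vΦ(vⁿ) = Φ(vⁿ) gives Φ(v)Φ(vⁿ) = Φ(vⁿ).
  have hdn : ∀ n : ℕ, n ≠ 0 → (1 - Φ v) * Φ (v ^ n) = 0 := by
    intro n hn0
    have h1 : v * Φ (v ^ n) = Φ (v ^ n) := by
      conv_lhs => rw [← hn n hn0, ← mul_assoc, hvq, hn n hn0]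
    have h2 := congrArg Φ h1
    rw [(hΦ.diagonal_mul hS (hΦ.map_mem hS _) v).2, hΦ.map_of_mem hS (hΦ.map_mem hS _)] at h2
    rw [sub_mul, one_mul, h2, sub_self]
  have hdp : IsStarProjection (1 - Φ v) := (hΦ.isStarProjection_map hS hvu hvs).one_sub
  have hcomm : Commute (1 - Φ v) v := by
    rw [commute_iff_eq, sub_mul, mul_sub, hΦ.mul_map_self hS hvu hvs, hΦ.map_mul_self hS hvu hvs,
      one_mul, mul_one]
  have h0 : (1 - Φ v) * q = 0 := by
    refine hΦ.eq_zero_of_mul_eq hS hvu hdp (sub_mem (one_mem _) (hΦ.map_mem hS v)) hcomm hdn ?_ ?_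
      ?_
    · intro n hn0
      have := congrArg star (hdn n hn0)
      rwa [star_mul, hΦ.star_map_self hS (hS.pow_mem_matUnitSums hvs n),
        hdp.isSelfAdjoint.star_eq, star_zero] at this
    · rw [← mul_assoc, ← hcomm.eq, mul_assoc, hvq]
    · rw [← mul_assoc, hdp.isIdempotentElem.eq]
  have h1 := congrArg star (hn 1 one_ne_zero)
  rw [pow_one, star_mul, hqp.isSelfAdjoint.star_eq, hΦ.star_map_self hS hvs] at h1
  rw [sub_mul, one_mul, sub_eq_zero] at h0
  exact h0.trans h1

end Dynamics

/-! ### Copies of x₀ on cylinders, which recover every P_μ. -/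

section Generators

variable {A : Type*} [CStarAlgebra A] {S : Fin 2 → A}

/-- The generator `x₀` of Thompson's group `F`. -/
noncomputable def xZero (S : Fin 2 → A) : A :=
  matUnit S [0] [0, 0] + matUnit S [1, 0] [0, 1] + matUnit S [1, 1] [1]

namespace IsCuntzFamily

theorem xZero_mem_thompsonF (hS : IsCuntzFamily S) : xZero S ∈ thompsonF S := by
  have h2 := hS.sum_two
  refine ⟨?_, {([0], [0, 0]), ([1, 0], [0, 1]), ([1, 1], [1])}, ?_, by decide⟩
  · rw [Unitary.mem_iff]
    constructor
    · have : star (xZero S) * xZero S =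
          S 0 * (S 0 * star (S 0) + S 1 * star (S 1)) * star (S 0) + S 1 * star (S 1) := by
        simp [xZero, matUnit, wordIsometry, add_mul, mul_add, mul_assoc, hS.star_mul_mul, add_assoc]
      rw [this, h2, mul_one, h2]
    · have : xZero S * star (xZero S) =
          S 0 * star (S 0) + S 1 * (S 0 * star (S 0) + S 1 * star (S 1)) * star (S 1) := by
        simp [xZero, matUnit, wordIsometry, add_mul, mul_add, mul_assoc, hS.star_mul_mul, add_assoc]
      rw [this, h2, mul_one, h2]
  · simp [tableSum, xZero, matUnit, add_assoc]

theorem cons_mem_thompsonF (hS : IsCuntzFamily S) {w : A} (hw : w ∈ thompsonF S) {i j : Fin 2}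
    (hij : i ≠ j) : S i * w * star (S i) + S j * star (S j) ∈ thompsonF S := by
  classical
  obtain ⟨hwu, J, rfl, hord⟩ := hw
  set w := tableSum S J
  have hij' := hS.star_mul_of_ne hij
  have hji' := hS.star_mul_of_ne hij.symm
  have hone : S i * star (S i) + S j * star (S j) = 1 := by
    have := hS.sum_two
    fin_cases i <;> fin_cases j <;> simp_all [add_comm]
  refine ⟨?_, insert ([j], [j]) (J.image fun p => (i :: p.1, i :: p.2)), ?_, ?_⟩
  · rw [Unitary.mem_iff]
    constructor
    · calc _ = S i * (star w * w) * star (S i) + S j * star (S j) := by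
            simp [add_mul, mul_add, mul_assoc, hS.star_mul_mul, hij, hij.symm]
        _ = 1 := by rw [Unitary.star_mul_self_of_mem hwu, mul_one, hone]
    · calc _ = S i * (w * star w) * star (S i) + S j * star (S j) := by
            simp [add_mul, mul_add, mul_assoc, hS.star_mul_mul, hij, hij.symm]
        _ = 1 := by rw [Unitary.mul_star_self_of_mem hwu, mul_one, hone]
  · rw [tableSum, Finset.sum_insert (by simp [hij]), Finset.sum_image (by
      rintro ⟨a, b⟩ _ ⟨c, d⟩ _ h
      simpa using h), add_comm]
    congr 1
    · simp [wordIsometry]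
    · simp only [w, tableSum, Finset.mul_sum, Finset.sum_mul, wordIsometry_cons, star_mul,
        mul_assoc]
  · intro p hp q hq h
    simp only [Finset.mem_insert, Finset.mem_image] at hp hq
    rcases hp with rfl | ⟨p, hp, rfl⟩ <;> rcases hq with rfl | ⟨q, hq, rfl⟩
    · exact absurd h (lt_irrefl _)
    · simp only [List.cons_lt_cons_iff, hij.symm, false_and, or_false] at h ⊢
      exact h
    · simp only [List.cons_lt_cons_iff, hij, false_and, or_false] at h ⊢
      exact h
    · simp only [List.cons_lt_cons_iff, lt_irrefl, true_and, false_or] at h ⊢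
      exact hord p hp q hq h

/-- For every word `μ` the group `F` contains a copy of `x₀` supported on the cylinder of `μ`. -/
theorem conj_xZero_mem_thompsonF (hS : IsCuntzFamily S) (μ : List (Fin 2)) :
    1 - wordProj S μ + wordIsometry S μ * xZero S * star (wordIsometry S μ) ∈ thompsonF S := by
  induction μ with
  | nil => simpa [wordProj_nil, wordIsometry_nil] using hS.xZero_mem_thompsonF
  | cons i μ ih =>
    obtain ⟨j, hij⟩ := exists_ne i
    have hone : S i * star (S i) + S j * star (S j) = 1 := by
      have := hS.sum_two
      fin_cases i <;> fin_cases j <;> simp_all [add_comm]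
    convert hS.cons_mem_thompsonF ih hij.symm using 1
    conv_lhs => rw [wordProj_cons, wordIsometry_cons, ← hone, star_mul]
    simp only [mul_add, mul_sub, add_mul, sub_mul, mul_one, mul_assoc]
    abel

end IsCuntzFamily

/-- No pair in the table of x₀ has equal words, so the copy on the cylinder of μ contributes nothing
to the expectation. -/
theorem IsPinchLimit.map_conj_xZero {Φ : A →ₗ[ℂ] A} (hΦ : IsPinchLimit S Φ) (hS : IsCuntzFamily S)
    (μ : List (Fin 2)) :
    Φ (1 - wordProj S μ + wordIsometry S μ * xZero S * star (wordIsometry S μ)) =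
      1 - wordProj S μ := by
  have h : wordIsometry S μ * xZero S * star (wordIsometry S μ) =
      matUnit S (μ ++ [0]) (μ ++ [0, 0]) + matUnit S (μ ++ [1, 0]) (μ ++ [0, 1]) +
        matUnit S (μ ++ [1, 1]) (μ ++ [1]) := by
    simp only [xZero, matUnit, wordIsometry_append, star_mul, mul_add, add_mul, mul_assoc]
  rw [map_add, map_sub, hΦ.map_one hS, hΦ.map_wordProj hS, h, map_add, map_add,
    hΦ.map_matUnit hS (by simp), hΦ.map_matUnit hS (by simp), hΦ.map_matUnit hS (by simp)]
  simp

end Generators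

end CuntzThompson

theorem corollary3p8 {A : Type*} [CStarAlgebra A] [PartialOrder A] [StarOrderedRing A]
    [Nontrivial A] (S : Fin 2 → A) (hS : CuntzThompson.IsCuntzFamily S)
    (α : A →⋆ₐ[ℂ] A) (hα : CuntzThompson.IsModestlyScaling S α)
    (hFV : ∀ w ∈ CuntzThompson.thompsonF S, α w ∈ CuntzThompson.thompsonV S) :
    (∃! Φ : A →ₗ[ℂ] A, CuntzThompson.IsDiagonalExpectation S Φ) ∧
    (∀ w ∈ CuntzThompson.thompsonF S,
      α (CuntzThompson.fixedProj S w) = CuntzThompson.fixedProj S (α w)) ∧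
    (CuntzThompson.diagonal S).map α ≤ CuntzThompson.diagonal S := by
  have hΦ := hS.isPinchLimit_diagonalExpectation
  have hmap : ∀ w ∈ CuntzThompson.thompsonF S,
      α (CuntzThompson.fixedProj S w) = CuntzThompson.fixedProj S (α w) := fun w hw =>
    hα.map_expectation hS hΦ hw (hFV w hw)
  refine ⟨hS.existsUnique_isDiagonalExpectation, hmap, ?_⟩
  rw [StarSubalgebra.map_le_iff_le_comap]
  have hc : Continuous α := map_continuous α
  refine StarSubalgebra.topologicalClosure_minimal (StarAlgebra.adjoin_le ?_)
    ((CuntzThompson.isClosed_diagonal S).preimage hc)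
  rintro _ ⟨μ, rfl⟩
  -- This reads 1 - α(P_μ) = Φ(α(w)) for the copy w of x₀ on the cylinder of μ, and the right side
  -- is in the diagonal.
  have h := hmap _ (hS.conj_xZero_mem_thompsonF μ)
  rw [CuntzThompson.fixedProj, hΦ.map_conj_xZero hS, map_sub, map_one, sub_eq_iff_eq_add,
    ← sub_eq_iff_eq_add'] at h
  change α (CuntzThompson.wordProj S μ) ∈ CuntzThompson.diagonal S
  rw [← h]
  exact sub_mem (one_mem _) (hΦ.map_mem hS _)
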